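/- Let $r,J\ge 0$ be integers, and let $p_1,\dots,p_J$ be noncommutative $*$-polynomials with complex coefficients in the variables $x_1,\dots,x_r,y_1,y_2,\dots$ (that is, noncommutative polynomials in these variables and their adjoints). Suppose that each $p_j$ is homogeneous in $\mathbf{x}=(x_1,\dots,x_r)$ of some degree $d_j\ge 1$, meaning $p_j(t\mathbf{x},\mathbf{y})=t^{d_j}p_j(\mathbf{x},\mathbf{y})$ for all real $t$. Let $C_j>0$ be constants, let $\{1,\dots,r\}=S_+\sqcup S_{\mathrm h}\sqcup S_{\mathrm g}$ be a partition (parts may be empty), let $D_k,E_k,F_k,G_k\ge 0$ be constants, and consider the relations \begin{align*} 0\le x_k\le D_k &\quad (k\in S_+), \tag{1}\\ -E_k\le x_k\le F_k &\quad (k\in S_{\mathrm h}), \tag{2}\\ \|x_k\|\le G_k &\quad (k\in S_{\mathrm g}), \tag{3}\\ \|p_j(\mathbf{x},\mathbf{y})\|\le C_j &\quad (1\le j\le J). \tag{4} \end{align*} Let $A$ be a (not necessarily unital) $C^*$-algebra with unitization $\widetilde A$, let $I$ be a closed two-sided ideal of $A$, and let $\pi:A\to A/I$ be the quotient map; scalars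 in (1) and (2) are multiples of the unit of $\widetilde A$. Suppose that $x_1,\dots,x_r$ and $y_1,y_2,\dots$ in $A$ are such that $(\mathbf{x},\mathbf{y})$ satisfies (1)–(3) and $(\pi(\mathbf{x}),\pi(\mathbf{y}))$ satisfies (4). Then there are $z_1,\dots,z_r$ in $A$ such that $(\mathbf{z},\mathbf{y})$ satisfies (1)–(4) and $\pi(z_k)=\pi(x_k)$ for all $k$. Moreover, there are such $z_k$ and a single $m\in 1+I\subseteq\widetilde A$ with $0\le m\le 1$ for which $$z_k=x_k^{1/2}m^2x_k^{1/2}\ (k\in S_+),\qquad z_k=m\,x_k\,m\ (k\in S_{\mathrm h}),\qquad z_k=x_k\,m^2\ (k\in S_{\mathrm g}).$$ -/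

import Mathlib

open scoped CStarAlgebra

universe u

noncomputable section

/-! ### Ideals and quotients of C⋆-algebras -/

/-- An ideal of a C⋆-algebra: a norm-closed, two-sided linear ideal. -/
structure CStarIdeal (A : Type u) [NonUnitalCStarAlgebra A] extends Submodule ℂ A where
  mul_mem_left' : ∀ (a : A) {b : A}, b ∈ carrier → a * b ∈ carrier
  mul_mem_right' : ∀ {a : A} (b : A), a ∈ carrier → a * b ∈ carrier
  isClosed' : IsClosed carrier

namespace CStarIdeal

variable {A : Type u} [NonUnitalCStarAlgebra A] (I : CStarIdeal A)

lemma mul_mem_left (a : A) {b : A} (hb : b ∈ I.toSubmodule) : a * b ∈ I.toSubmodule :=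
  I.mul_mem_left' a hb

lemma mul_mem_right {a : A} (b : A) (ha : a ∈ I.toSubmodule) : a * b ∈ I.toSubmodule :=
  I.mul_mem_right' b ha

instance isClosed : IsClosed (I.toSubmodule : Set A) := I.isClosed'

/-- Every element of an ideal has arbitrarily good self-adjoint right units in the ideal. -/
lemma exists_right_unit {a : A} (ha : a ∈ I.toSubmodule) {ε : ℝ} (hε : 0 < ε) :
    ∃ v ∈ I.toSubmodule, IsSelfAdjoint v ∧ ‖a - a * v‖ ≤ ε ∧ ∀ x : A, ‖x - x * v‖ ≤ ‖x‖ := by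
  obtain ⟨η, hη, hηε⟩ : ∃ η : ℝ, 0 < η ∧ η = ε ^ 2 := ⟨ε ^ 2, by positivity, rfl⟩
  have hpos : ∀ t : ℝ, 0 < t ^ 2 + η ^ 2 := fun t => by positivity
  have hne : ∀ t : ℝ, t ^ 2 + η ^ 2 ≠ 0 := fun t => (hpos t).ne'
  set f : ℝ → ℝ := fun t => t ^ 2 / (t ^ 2 + η ^ 2) with hf
  set g : ℝ → ℝ := fun t => t / (t ^ 2 + η ^ 2) with hg
  have hfc : Continuous f := by
    rw [hf]; exact Continuous.div (by fun_prop) (by fun_prop) hne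
  have hgc : Continuous g := by
    rw [hg]; exact Continuous.div (by fun_prop) (by fun_prop) hne
  have hb : IsSelfAdjoint (star a * a) := IsSelfAdjoint.star_mul_self a
  have hvmem : cfcₙ f (star a * a) = (star a * a) * cfcₙ g (star a * a) := by
    have h1 : f = fun t => t * g t := by
      funext t; simp only [hf, hg]; ring
    rw [h1, cfcₙ_mul (fun t : ℝ => t) g (star a * a) (by fun_prop) rfl
      hgc.continuousOn (by simp [hg]), cfcₙ_id' ℝ (star a * a)]
  have hcoe : ((cfcₙ f (star a * a) : A) : A⁺¹) = cfc f ((star a * a : A) : A⁺¹) :=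
    Unitization.real_cfcₙ_eq_cfc_inr _ _ (by simp [hf])
  have hb' : IsSelfAdjoint ((star a * a : A) : A⁺¹) := hb.inr ℂ
  have hsub : (1 : A⁺¹) - cfc f ((star a * a : A) : A⁺¹)
      = cfc (fun t => 1 - f t) ((star a * a : A) : A⁺¹) := by
    rw [cfc_sub (fun _ => (1 : ℝ)) f _ (by fun_prop) hfc.continuousOn, cfc_const_one ℝ _]
  have h1f : ∀ t : ℝ, 1 - f t = η ^ 2 / (t ^ 2 + η ^ 2) := fun t => by
    have := hne t; simp only [hf]; field_simp; ring
  have hone : ‖(1 : A⁺¹) - cfc f ((star a * a : A) : A⁺¹)‖ ≤ 1 := by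
    rw [hsub]
    refine norm_cfc_le zero_le_one fun t _ => ?_
    rw [h1f, Real.norm_of_nonneg (by positivity), div_le_one (hpos t)]
    nlinarith [sq_nonneg t]
  have hcoe' : ∀ x : A, ((x - x * cfcₙ f (star a * a) : A) : A⁺¹)
      = (x : A⁺¹) * (1 - cfc f ((star a * a : A) : A⁺¹)) := fun x => by
    rw [Unitization.inr_sub, Unitization.inr_mul, hcoe, mul_sub, mul_one]
  refine ⟨cfcₙ f (star a * a), ?_, cfcₙ_predicate f _, ?_, fun x => ?_⟩
  · rw [hvmem]
    exact I.mul_mem_right _ (I.mul_mem_left _ ha)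
  · have key : ‖a - a * cfcₙ f (star a * a)‖ ^ 2 ≤ η := by
      rw [← Unitization.norm_inr (𝕜 := ℂ), hcoe', sq, ← CStarRing.norm_star_mul_self, hsub,
        star_mul, (cfc_predicate (R := ℝ) (p := IsSelfAdjoint) (fun t => 1 - f t) _).star_eq]
      have h2 : cfc (fun t => 1 - f t) ((star a * a : A) : A⁺¹) * star (a : A⁺¹) *
          ((a : A⁺¹) * cfc (fun t => 1 - f t) ((star a * a : A) : A⁺¹))
          = cfc (fun t => (1 - f t) * (t * (1 - f t))) ((star a * a : A) : A⁺¹) := by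
        rw [cfc_mul (fun t => 1 - f t) (fun t => t * (1 - f t)) _
          (by fun_prop) (by fun_prop),
          cfc_mul (fun t : ℝ => t) (fun t => 1 - f t) _ (by fun_prop) (by fun_prop),
          cfc_id' ℝ _]
        simp only [mul_assoc, Unitization.inr_mul, Unitization.inr_star]
      rw [h2]
      refine norm_cfc_le hη.le fun t _ => ?_
      rw [h1f, Real.norm_eq_abs, abs_mul, abs_mul,
        abs_of_nonneg (by positivity : 0 ≤ η ^ 2 / (t ^ 2 + η ^ 2))]
      have h3 : η ^ 2 / (t ^ 2 + η ^ 2) ≤ 1 := by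
        rw [div_le_one (hpos t)]; nlinarith [sq_nonneg t]
      have h4 : |t| * (η ^ 2 / (t ^ 2 + η ^ 2)) ≤ η := by
        rw [← mul_div_assoc, div_le_iff₀ (hpos t), ← sq_abs t]
        nlinarith [sq_nonneg (|t| - η), abs_nonneg t, mul_nonneg hη.le (sq_nonneg (|t| - η)),
          mul_nonneg hη.le (sq_nonneg |t|), mul_nonneg hη.le (sq_nonneg η)]
      calc η ^ 2 / (t ^ 2 + η ^ 2) * (|t| * (η ^ 2 / (t ^ 2 + η ^ 2))) ≤ 1 * η := by
            gcongr
        _ = η := one_mul η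
    rw [hηε] at key
    exact le_of_sq_le_sq key hε.le
  · rw [← Unitization.norm_inr (𝕜 := ℂ), hcoe', ← Unitization.norm_inr (𝕜 := ℂ) (a := x)]
    exact (norm_mul_le _ _).trans (mul_le_of_le_one_right (norm_nonneg _) hone)

/-- Closed two-sided ideals of C⋆-algebras are self-adjoint. -/
lemma star_mem {a : A} (ha : a ∈ I.toSubmodule) : star a ∈ I.toSubmodule := by
  have hcl : star a ∈ closure (I.toSubmodule : Set A) := by
    rw [Metric.mem_closure_iff]
    intro ε hε
    obtain ⟨v, hv, hvs, hav, -⟩ := I.exists_right_unit ha (half_pos hε)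
    refine ⟨v * star a, I.mul_mem_right _ hv, ?_⟩
    have : star a - v * star a = star (a - a * v) := by
      rw [star_sub, star_mul, hvs.star_eq]
    rw [dist_eq_norm, this, norm_star]
    linarith
  rwa [I.isClosed.closure_eq] at hcl

/-- The quotient `A / I`, with the quotient norm. -/
def Quotient : Type u := A ⧸ I.toSubmodule

namespace Quotient

instance : NormedAddCommGroup I.Quotient := inferInstanceAs (NormedAddCommGroup (A ⧸ I.toSubmodule))

instance : NormedSpace ℂ I.Quotient := inferInstanceAs (NormedSpace ℂ (A ⧸ I.toSubmodule))

instance : CompleteSpace I.Quotient := inferInstanceAs (CompleteSpace (A ⧸ I.toSubmodule))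

/-- The quotient map as a function. -/
def mk (a : A) : I.Quotient := Submodule.Quotient.mk a

lemma mk_surjective : Function.Surjective (mk I) := Submodule.Quotient.mk_surjective _

lemma mk_eq_mk {a b : A} : mk I a = mk I b ↔ a - b ∈ I.toSubmodule :=
  Submodule.Quotient.eq _

lemma norm_mk_le (a : A) : ‖mk I a‖ ≤ ‖a‖ := Submodule.Quotient.norm_mk_le _ a

lemma exists_norm_lt (x : I.Quotient) {ε : ℝ} (hε : 0 < ε) :
    ∃ a : A, mk I a = x ∧ ‖a‖ < ‖x‖ + ε :=
  Submodule.Quotient.norm_mk_lt x hε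

instance : Mul I.Quotient where
  mul := _root_.Quotient.map₂ (· * ·) (by
    intro a a' ha b b' hb
    have ha' : a - a' ∈ I.toSubmodule := (Submodule.quotientRel_def _).1 ha
    have hb' : b - b' ∈ I.toSubmodule := (Submodule.quotientRel_def _).1 hb
    refine (Submodule.quotientRel_def _).2 ?_
    have h : a * b - a' * b' = (a - a') * b + a' * (b - b') := by
      rw [sub_mul, mul_sub]; abel
    rw [h]
    exact add_mem (I.mul_mem_right _ ha') (I.mul_mem_left _ hb'))

instance : Star I.Quotient where
  star := _root_.Quotient.map star (by
    intro a a' ha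
    have ha' : a - a' ∈ I.toSubmodule := (Submodule.quotientRel_def _).1 ha
    refine (Submodule.quotientRel_def _).2 ?_
    rw [← star_sub]
    exact I.star_mem ha')

lemma mk_add (a b : A) : mk I (a + b) = mk I a + mk I b := rfl
lemma mk_zero : mk I 0 = 0 := rfl
lemma mk_smul (c : ℂ) (a : A) : mk I (c • a) = c • mk I a := rfl
lemma mk_mul (a b : A) : mk I (a * b) = mk I a * mk I b := rfl
lemma mk_star (a : A) : mk I (star a) = star (mk I a) := rfl

lemma norm_le_of_forall {x : I.Quotient} {c : ℝ}
    (h : ∀ ε : ℝ, 0 < ε → ∃ a : A, mk I a = x ∧ ‖a‖ ≤ c + ε) : ‖x‖ ≤ c := by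
  refine le_of_forall_pos_le_add fun ε hε => ?_
  obtain ⟨a, rfl, ha⟩ := h ε hε
  exact (norm_mk_le I a).trans ha

lemma norm_mul_le' (x y : I.Quotient) : ‖x * y‖ ≤ ‖x‖ * ‖y‖ := by
  have hlim : Filter.Tendsto (fun ε : ℝ => (‖x‖ + ε) * (‖y‖ + ε)) (nhdsWithin 0 (Set.Ioi 0))
      (nhds (‖x‖ * ‖y‖)) := by
    have h : Continuous fun ε : ℝ => (‖x‖ + ε) * (‖y‖ + ε) := by fun_prop
    simpa using (h.tendsto 0).mono_left nhdsWithin_le_nhds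
  refine ge_of_tendsto hlim ?_
  filter_upwards [self_mem_nhdsWithin] with ε hε
  have hε : 0 < ε := hε
  obtain ⟨a, rfl, ha⟩ := exists_norm_lt I x hε
  obtain ⟨b, rfl, hb⟩ := exists_norm_lt I y hε
  rw [← mk_mul]
  calc ‖mk I (a * b)‖ ≤ ‖a * b‖ := norm_mk_le I _
    _ ≤ ‖a‖ * ‖b‖ := norm_mul_le a b
    _ ≤ (‖mk I a‖ + ε) * (‖mk I b‖ + ε) := by gcongr

instance : NonUnitalNormedRing I.Quotient where
  left_distrib x y z := by
    obtain ⟨a, rfl⟩ := mk_surjective I x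
    obtain ⟨b, rfl⟩ := mk_surjective I y
    obtain ⟨c, rfl⟩ := mk_surjective I z
    simp only [← mk_add, ← mk_mul, mul_add]
  right_distrib x y z := by
    obtain ⟨a, rfl⟩ := mk_surjective I x
    obtain ⟨b, rfl⟩ := mk_surjective I y
    obtain ⟨c, rfl⟩ := mk_surjective I z
    simp only [← mk_add, ← mk_mul, add_mul]
  zero_mul x := by
    obtain ⟨a, rfl⟩ := mk_surjective I x
    simp only [← mk_zero, ← mk_mul, zero_mul]
  mul_zero x := by
    obtain ⟨a, rfl⟩ := mk_surjective I x
    simp only [← mk_zero, ← mk_mul, mul_zero]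
  mul_assoc x y z := by
    obtain ⟨a, rfl⟩ := mk_surjective I x
    obtain ⟨b, rfl⟩ := mk_surjective I y
    obtain ⟨c, rfl⟩ := mk_surjective I z
    simp only [← mk_mul, mul_assoc]
  dist_eq := dist_eq_norm_neg_add
  norm_mul_le := norm_mul_le' I

instance : StarRing I.Quotient where
  star_involutive x := by
    obtain ⟨a, rfl⟩ := mk_surjective I x
    simp only [← mk_star, star_star]
  star_mul x y := by
    obtain ⟨a, rfl⟩ := mk_surjective I x
    obtain ⟨b, rfl⟩ := mk_surjective I y
    simp only [← mk_star, ← mk_mul, star_mul]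
  star_add x y := by
    obtain ⟨a, rfl⟩ := mk_surjective I x
    obtain ⟨b, rfl⟩ := mk_surjective I y
    simp only [← mk_star, ← mk_add, star_add]

lemma norm_mul_self_le' (x : I.Quotient) : ‖x‖ * ‖x‖ ≤ ‖star x * x‖ := by
  obtain ⟨a, rfl⟩ := mk_surjective I x
  rw [← mk_star, ← mk_mul]
  set q := ‖mk I (star a * a)‖ with hq
  have hq0 : 0 ≤ q := norm_nonneg _
  refine le_of_forall_pos_le_add fun ε hε => ?_
  obtain ⟨b, hb, hbn⟩ := exists_norm_lt I (mk I (star a * a)) (half_pos hε)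
  have hi : star a * a - b ∈ I.toSubmodule := (mk_eq_mk I).1 hb.symm
  obtain ⟨v, hv, hvs, hv1, hv2⟩ := I.exists_right_unit hi (half_pos hε)
  have h1 : ‖mk I a‖ ≤ ‖a - a * v‖ := by
    have : mk I a = mk I (a - a * v) := by
      rw [mk_eq_mk, sub_sub_cancel]; exact I.mul_mem_left _ hv
    rw [this]; exact norm_mk_le I _
  have h2 : ‖a - a * v‖ * ‖a - a * v‖ ≤ ‖star a * a - star a * a * v‖ := by
    rw [← CStarRing.norm_star_mul_self]
    have e : star (a - a * v) * (a - a * v)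
        = star (star (star a * a - star a * a * v) - star (star a * a - star a * a * v) * v) := by
      simp only [star_sub, star_mul, star_star, hvs.star_eq, mul_sub, sub_mul, mul_assoc]
      abel
    rw [e, norm_star]
    exact (hv2 _).trans_eq (norm_star _)
  have h3 : star a * a - star a * a * v
      = ((star a * a - b) - (star a * a - b) * v) + (b - b * v) := by
    rw [sub_mul]; abel
  calc ‖mk I a‖ * ‖mk I a‖ ≤ ‖a - a * v‖ * ‖a - a * v‖ := by gcongr
    _ ≤ ‖star a * a - star a * a * v‖ := h2
    _ ≤ ‖(star a * a - b) - (star a * a - b) * v‖ + ‖b - b * v‖ := by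
        rw [h3]; exact norm_add_le _ _
    _ ≤ ε / 2 + (q + ε / 2) := add_le_add hv1 ((hv2 b).trans hbn.le)
    _ = q + ε := by ring

instance : NonUnitalCStarAlgebra I.Quotient where
  norm_mul_self_le := norm_mul_self_le' I
  smul_assoc c x y := by
    obtain ⟨a, rfl⟩ := mk_surjective I x
    obtain ⟨b, rfl⟩ := mk_surjective I y
    simp only [smul_eq_mul, ← mk_smul, ← mk_mul, smul_mul_assoc]
  smul_comm c x y := by
    obtain ⟨a, rfl⟩ := mk_surjective I x
    obtain ⟨b, rfl⟩ := mk_surjective I y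
    simp only [smul_eq_mul, ← mk_smul, ← mk_mul, mul_smul_comm]
  star_smul c x := by
    obtain ⟨a, rfl⟩ := mk_surjective I x
    simp only [← mk_smul, ← mk_star, star_smul]

end Quotient

/-- The quotient map `π : A → A / I`, a ⋆-homomorphism. -/
def π : A →⋆ₙₐ[ℂ] I.Quotient where
  toFun := Quotient.mk I
  map_smul' _ _ := rfl
  map_zero' := rfl
  map_add' _ _ := rfl
  map_mul' _ _ := rfl
  map_star' _ := rfl

end CStarIdeal

/-! ### Noncommutative ⋆-polynomials -/

/-- The letters of noncommutative ⋆-polynomials: a variable or its adjoint. -/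
inductive StarLetter (V : Type) : Type
  | var (v : V) : StarLetter V
  | adj (v : V) : StarLetter V

/-- Noncommutative ⋆-polynomials with complex coefficients (and possibly a constant term) in the
variables `V`: noncommutative polynomials in the variables and their adjoints. -/
abbrev NCStarPoly (V : Type) : Type := FreeAlgebra ℂ (StarLetter V)

/-- The variables `x₁, …, x_r` (left summand) and `y₁, y₂, …` (right summand). -/
abbrev MixedVar (r : ℕ) : Type := Fin r ⊕ ℕ

namespace NCStarPoly

/-- The value of a ⋆-polynomial at elements of a C⋆-algebra `A`, in the unitization of `A`
(constants go to multiples of the adjoined unit). -/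
def eval {V : Type} {A : Type u} [NonUnitalCStarAlgebra A] (w : V → A) (p : NCStarPoly V) : A⁺¹ :=
  FreeAlgebra.lift ℂ
    (fun l : StarLetter V => match l with
      | .var v => ((w v : A) : A⁺¹)
      | .adj v => ((star (w v) : A) : A⁺¹)) p

/-- `p(𝐱, 𝐲) ↦ p(t𝐱, 𝐲)` for a real scalar `t`. -/
def scaleX {r : ℕ} (t : ℝ) : NCStarPoly (MixedVar r) →ₐ[ℂ] NCStarPoly (MixedVar r) :=
  FreeAlgebra.lift ℂ
    (fun l : StarLetter (MixedVar r) => match l with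
      | .var (.inl k) => (t : ℂ) • FreeAlgebra.ι ℂ (.var (.inl k))
      | .adj (.inl k) => (t : ℂ) • FreeAlgebra.ι ℂ (.adj (.inl k))
      | .var (.inr n) => FreeAlgebra.ι ℂ (.var (.inr n))
      | .adj (.inr n) => FreeAlgebra.ι ℂ (.adj (.inr n)))

/-- `p` is `d`-homogeneous in the first `r` variables: `p(t𝐱, 𝐲) = t ^ d p(𝐱, 𝐲)` for all
real `t`. -/
def IsHomogeneousInX {r : ℕ} (p : NCStarPoly (MixedVar r)) (d : ℕ) : Prop :=
  ∀ t : ℝ, scaleX t p = ((t : ℂ) ^ d) • p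

end NCStarPoly

/-- The type of a variable: positive, hermitian or general. A partition of the index set of the
variables into three parts is a function to this type. -/
inductive VarKind : Type
  | pos
  | herm
  | gen

/-- The individual restriction on a variable `x` of the given kind: `0 ≤ x ≤ D`,
`-E ≤ x ≤ F` or `‖x‖ ≤ G`. Scalars are multiples of the unit of the unitization. -/
def VarKind.Restriction {A : Type u} [NonUnitalCStarAlgebra A] [PartialOrder A] [StarOrderedRing A]
    (D E F G : ℝ) (x : A) : VarKind → Prop
  | .pos => 0 ≤ x ∧ (x : A⁺¹) ≤ algebraMap ℂ A⁺¹ D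
  | .herm => -algebraMap ℂ A⁺¹ E ≤ (x : A⁺¹) ∧ (x : A⁺¹) ≤ algebraMap ℂ A⁺¹ F
  | .gen => ‖x‖ ≤ G

/-- The lift of `x` determined by the multiplier `m` in the unitization: `x^{1/2} m² x^{1/2}`,
`m x m` or `x m²`. -/
def VarKind.adjust {A : Type u} [NonUnitalCStarAlgebra A] [PartialOrder A] [StarOrderedRing A]
    (m : A⁺¹) (x : A) : VarKind → A⁺¹
  | .pos => (CFC.sqrt x : A) * m ^ 2 * (CFC.sqrt x : A)
  | .herm => m * x * m
  | .gen => x * m ^ 2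

end

/-! Every multiplier `m ∈ 1 + I` with `0 ≤ m ≤ 1` gives a tuple `z` with `π z = π x` that still
satisfies (1)–(3), so only the norms in (4) have to be brought down. The multiplier is a limit of
corrections of `1`.

One correction replaces `m` by `m' = m^{1/2} (1 - δu) m^{1/2}`, with `u` far along a quasi-central
approximate unit of `I`. Put `w = 1 - δu`. As `u` asymptotically commutes with everything and each
`z_k` contains `m` twice, the new `z_k` is close to `z_k w²`. By homogeneity `p_j(z')` is close to
`p_j(z) w^{2 d_j}`, and since `w` is a contraction and `d_j ≥ 1` its norm is almost bounded by
`‖p_j(z) w‖` (`tendsto_word_sub`, `tendsto_eval_sub`).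

Akemann–Pedersen norm reduction (`norm_mul_sq_le`) controls that quantity: if `‖π a‖ ≤ C`, `‖a‖ ≤ C
+ ε` and `(1 - δ)(C + ε) ≤ C`, then `‖a(1 - δu)‖` is eventually below `C + η` for every `η > 0`.
Thus the excess `ε` shrinks to any prescribed `η` at the cost `‖m - m'‖ ≤ δ`
(`exists_norm_reduction`).

All `C_j` are at least some `c > 0`, so `δ = ε / (c + ε)` works for every `j`. Halving the excess at
each step makes the `δ`'s summable; the multipliers converge in the closed set `1 + I`, and
continuity of the polynomials gives (4) exactly (`exists_multiplier`). -/

open Filter Topology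

/-! ### Quasi-central approximate units. -/

section ApproximateUnits

variable {B : Type u} [CStarAlgebra B]

/-- A sum of `N` elements, with almost orthogonal ranges of their adjoints, has norm of
order `√N`. -/
lemma norm_sum_sq_le {N : ℕ} (X : ℕ → B) {M η : ℝ}
    (hM : ∀ k, ‖X k‖ ≤ M) (hX : ∀ k l, k < l → ‖X l * star (X k)‖ ≤ η) :
    ‖∑ k ∈ Finset.range N, X k‖ ^ 2 ≤ N * M ^ 2 + N ^ 2 * η := by
  have hM0 : 0 ≤ M := (norm_nonneg _).trans (hM 0)
  have hη0 : 0 ≤ η := (norm_nonneg _).trans (hX 0 1 one_pos)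
  have hX' : ∀ k l, k ≠ l → ‖X k * star (X l)‖ ≤ η := fun k l hkl => by
    rcases lt_or_gt_of_ne hkl with h | h
    · rw [← norm_star, star_mul, star_star]; exact hX k l h
    · exact hX l k h
  rw [sq, ← CStarRing.norm_self_mul_star, star_sum, Finset.sum_mul_sum]
  calc ‖∑ i ∈ Finset.range N, ∑ j ∈ Finset.range N, X i * star (X j)‖
      ≤ ∑ i ∈ Finset.range N, ∑ j ∈ Finset.range N, ((if i = j then M ^ 2 else 0) + η) := by
        refine norm_sum_le_of_le _ fun i _ => norm_sum_le_of_le _ fun j _ => ?_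
        split_ifs with h
        · subst h
          refine (norm_mul_le _ _).trans ?_
          rw [norm_star]
          nlinarith [hM i, norm_nonneg (X i)]
        · simpa using hX' i j h
    _ = N * M ^ 2 + N ^ 2 * η := by
        simp only [Finset.sum_add_distrib, Finset.sum_ite_eq, Finset.sum_const, Finset.card_range,
          nsmul_eq_mul]
        rw [Finset.sum_congr rfl (g := fun _ => M ^ 2) fun i hi => if_pos hi]
        simp; ring

variable [PartialOrder B] [StarOrderedRing B]

/-- Finitely many elements of an ideal have a common approximate right unit in the ideal. -/
lemma exists_approx_unit (I : Ideal B) [I.IsTwoSided] (H : Finset B) {η : ℝ} (hη : 0 < η) :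
    ∃ u ∈ I, 0 ≤ u ∧ u ≤ 1 ∧ ∀ h ∈ H, h ∈ I → ‖h - h * u‖ ≤ η := by
  classical
  set H' := H.filter (· ∈ I)
  set b : B := ∑ h ∈ H', star h * h with hbdef
  have hb : 0 ≤ b := Finset.sum_nonneg fun h _ => star_mul_self_nonneg h
  have hbI : b ∈ I := sum_mem fun h hh => I.mul_mem_left _ (Finset.mem_filter.1 hh).2
  have hbs : IsSelfAdjoint b := hb.isSelfAdjoint
  -- The unit is `u = b (b + κ)⁻¹`. Since `h⋆ h ≤ b`, the square of `‖h (1 - u)‖` is at most the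
  -- norm of `κ² b (b + κ)⁻²`, hence at most `κ = η²`. Writing `|t|` keeps the functions continuous
  -- on all of `ℝ`.
  set κ := η ^ 2 with hκ
  have hκ0 : 0 < κ := by positivity
  have hpos : ∀ t : ℝ, 0 < |t| + κ := fun t => by positivity
  have hne : ∀ t : ℝ, |t| + κ ≠ 0 := fun t => (hpos t).ne'
  have hspec : ∀ t ∈ spectrum ℝ b, 0 ≤ t := fun t ht => spectrum_nonneg_of_nonneg hb ht
  have hgc : Continuous fun t : ℝ => (|t| + κ)⁻¹ := Continuous.inv₀ (by fun_prop) hne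
  have hgc' : Continuous fun t : ℝ => κ * (|t| + κ)⁻¹ := continuous_const.mul hgc
  set u : B := cfc (fun t : ℝ => t * (|t| + κ)⁻¹) b with hu
  have hub : u = b * cfc (fun t : ℝ => (|t| + κ)⁻¹) b := by
    rw [hu, cfc_mul (fun t : ℝ => t) (fun t => (|t| + κ)⁻¹) b (by fun_prop) hgc.continuousOn,
      cfc_id' ℝ b]
  have hu0 : 0 ≤ u := cfc_nonneg fun t ht => mul_nonneg (hspec t ht) (inv_nonneg.2 (hpos t).le)
  have hu1 : u ≤ 1 := cfc_le_one _ _ fun t ht => by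
    rw [← div_eq_mul_inv, div_le_one (hpos t)]
    linarith [le_abs_self t]
  have hv : 1 - u = cfc (fun t : ℝ => κ * (|t| + κ)⁻¹) b := by
    rw [hu, ← cfc_const_one ℝ b, ← cfc_sub (fun _ => (1 : ℝ)) _ b (by fun_prop) (by fun_prop)]
    refine cfc_congr fun t ht => ?_
    have h0 := hspec t ht
    have := hne t
    rw [abs_of_nonneg h0] at this ⊢
    field_simp
    ring
  have hvs : star (1 - u) = 1 - u := (IsSelfAdjoint.one B).sub hu0.isSelfAdjoint
  refine ⟨u, hub ▸ I.mul_mem_right _ hbI, hu0, hu1, fun h hh hhI => ?_⟩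
  have hle : star h * h ≤ b :=
    Finset.single_le_sum (f := fun h => star h * h) (fun h _ => star_mul_self_nonneg h)
      (Finset.mem_filter.2 ⟨hh, hhI⟩)
  have h1 : ‖h - h * u‖ * ‖h - h * u‖ ≤ κ := by
    rw [← CStarRing.norm_star_mul_self]
    have e : star (h - h * u) * (h - h * u) = star (1 - u) * (star h * h) * (1 - u) := by
      rw [show h - h * u = h * (1 - u) by rw [mul_sub, mul_one], star_mul]
      simp only [mul_assoc]
    have hnn : 0 ≤ star (1 - u) * (star h * h) * (1 - u) :=
      star_left_conjugate_nonneg (star_mul_self_nonneg h) _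
    rw [e]
    refine (CStarAlgebra.norm_le_norm_of_nonneg_of_le hnn
      (star_left_conjugate_le_conjugate hle _)).trans ?_
    rw [hvs, hv]
    have e2 : cfc (fun t : ℝ => κ * (|t| + κ)⁻¹) b * b * cfc (fun t : ℝ => κ * (|t| + κ)⁻¹) b
        = cfc (fun t : ℝ => κ * (|t| + κ)⁻¹ * t * (κ * (|t| + κ)⁻¹)) b := by
      rw [cfc_mul (fun t : ℝ => κ * (|t| + κ)⁻¹ * t) _ b (hgc'.mul continuous_id).continuousOn hgc'.continuousOn,
        cfc_mul (fun t : ℝ => κ * (|t| + κ)⁻¹) (fun t => t) b hgc'.continuousOn (by fun_prop),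
        cfc_id' ℝ b]
    rw [e2]
    refine norm_cfc_le hκ0.le fun t ht => ?_
    have h0 := hspec t ht
    rw [abs_of_nonneg h0, Real.norm_of_nonneg (by positivity)]
    have hp : 0 < t + κ := by linarith
    have h3 : κ * (t + κ)⁻¹ ≤ 1 := by
      rw [← div_eq_mul_inv, div_le_one hp]; linarith
    have h4 : (t + κ)⁻¹ * t ≤ 1 := by
      rw [inv_mul_le_one₀ hp]; linarith
    calc κ * (t + κ)⁻¹ * t * (κ * (t + κ)⁻¹) ≤ κ * ((t + κ)⁻¹ * t) * 1 := by
          rw [mul_assoc κ]; gcongr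
      _ ≤ κ * 1 * 1 := by gcongr
      _ = κ := by ring
  exact abs_le_of_sq_le_sq' (by rw [sq, sq]; simpa [hκ, sq] using h1) hη.le |>.2

lemma norm_one_sub_le_one {u : B} (h0 : 0 ≤ u) (h1 : u ≤ 1) : ‖1 - u‖ ≤ 1 :=
  (CStarAlgebra.norm_le_one_iff_of_nonneg (1 - u) (sub_nonneg.2 h1)).2 (sub_le_self _ h0)

lemma norm_le_one_of_nonneg_of_le_one {u : B} (h0 : 0 ≤ u) (h1 : u ≤ 1) : ‖u‖ ≤ 1 :=
  (CStarAlgebra.norm_le_one_iff_of_nonneg u h0).2 h1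

/-- Successive approximate units, each one almost a unit for everything that was built from the
previous ones. -/
lemma exists_approx_unit_seq (I : Ideal B) [I.IsTwoSided] (F : Finset B) {η : ℝ} (hη : 0 < η) :
    ∃ u : ℕ → B, (∀ k, u k ∈ I ∧ 0 ≤ u k ∧ u k ≤ 1 ∧ ∀ h ∈ F, h ∈ I → ‖h - h * u k‖ ≤ η) ∧
      ∀ f ∈ F, ∀ k l, k < l →
        ‖(1 - u l) * f * u l * star ((1 - u k) * f * u k)‖ ≤ (1 + ‖f‖) * η := by
  classical
  choose U hUI hU0 hU1 hU using fun H : Finset B => exists_approx_unit I H hη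
  -- Stage `n + 1` records `X = (1 - u) f u` and `X f⋆` for the unit `u` chosen at stage `n`. A
  -- later unit `v` then satisfies `v X⋆ ≈ X⋆` and `(1 - v) f X⋆ = (X f⋆ (1 - v))⋆ ≈ 0`, which gives
  -- the almost orthogonality.
  let H : ℕ → Finset B := fun n => Nat.rec F (fun _ K =>
    K ∪ (F.image (fun f => (1 - U K) * f * U K) ∪
      F.image (fun f => (1 - U K) * f * U K * star f))) n
  have hsucc : ∀ n, H (n + 1) = H n ∪ (F.image (fun f => (1 - U (H n)) * f * U (H n)) ∪
      F.image (fun f => (1 - U (H n)) * f * U (H n) * star f)) := fun n => rfl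
  have hmono : Monotone H := monotone_nat_of_le_succ fun n => by
    rw [hsucc]; exact Finset.subset_union_left
  refine ⟨fun n => U (H n), fun k => ⟨hUI _, hU0 _, hU1 _, fun h hh hhI =>
    hU _ h (hmono (Nat.zero_le k) hh) hhI⟩, fun f hf k l hkl => ?_⟩
  set X : B := (1 - U (H k)) * f * U (H k) with hXdef
  have hXI : X ∈ I := I.mul_mem_left _ (hUI _)
  have hXk : X ∈ H l := hmono (Nat.succ_le_of_lt hkl) <| by
    rw [hsucc, Finset.mem_union, Finset.mem_union]
    exact .inr (.inl (Finset.mem_image_of_mem _ hf))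
  have hXk' : X * star f ∈ H l := hmono (Nat.succ_le_of_lt hkl) <| by
    rw [hsucc, Finset.mem_union, Finset.mem_union]
    exact .inr (.inr (Finset.mem_image.2 ⟨f, hf, rfl⟩))
  have h1 := hU _ _ hXk hXI
  have h2 := hU _ _ hXk' (I.mul_mem_right _ hXI)
  set v := U (H l)
  have hvs : star v = v := (hU0 (H l)).isSelfAdjoint.star_eq
  have hv : ‖1 - v‖ ≤ 1 := norm_one_sub_le_one (hU0 _) (hU1 _)
  have e : (1 - v) * f * v * star X =
      star (X * star f - X * star f * v) - (1 - v) * f * star (X - X * v) := by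
    simp only [star_sub, star_mul, star_star, hvs]
    noncomm_ring
  rw [e]
  calc _ ≤ ‖star (X * star f - X * star f * v)‖ + ‖(1 - v) * f * star (X - X * v)‖ :=
        norm_sub_le _ _
    _ ≤ η + 1 * ‖f‖ * η := by
        refine add_le_add (by rwa [norm_star]) ?_
        refine (norm_mul_le _ _).trans ?_
        rw [norm_star]
        refine mul_le_mul ((norm_mul_le _ _).trans ?_) h1 (norm_nonneg _) (by positivity)
        gcongr
    _ = (1 + ‖f‖) * η := by ring

/-- Quasi-central approximate units, for finitely many elements. -/
lemma exists_quasicentral (I : Ideal B) [I.IsTwoSided] (F : Finset B) {ε : ℝ} (hε : 0 < ε) :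
    ∃ u ∈ I, 0 ≤ u ∧ u ≤ 1 ∧ (∀ f ∈ F, ‖u * f - f * u‖ ≤ ε) ∧
      ∀ h ∈ F, h ∈ I → ‖h - h * u‖ ≤ ε := by
  classical
  -- Closed under adjoints, because `u f - f u = ((1 - u) f⋆ u)⋆ - (1 - u) f u`. Averaging `N`
  -- successive units divides a sum of size about `√N` by `N`, so the commutators become small.
  set F' := F ∪ F.image star with hF'
  obtain ⟨M, hM⟩ : ∃ M : ℝ, ∀ f ∈ F', ‖f‖ ≤ M :=
    ⟨∑ f ∈ F', ‖f‖, fun f hf =>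
      Finset.single_le_sum (f := fun f : B => ‖f‖) (fun f _ => norm_nonneg f) hf⟩
  obtain ⟨N, hN⟩ := exists_nat_gt (max 1 (M ^ 2 * 8 / ε ^ 2))
  have hN0 : (0 : ℝ) < N := by linarith [le_max_left 1 (M ^ 2 * 8 / ε ^ 2)]
  have hNM : M ^ 2 * 8 ≤ N * ε ^ 2 := by
    rw [← div_le_iff₀ (by positivity)]
    exact (le_max_right _ _).trans hN.le
  -- With this `η` and `N`, both terms of `N M² + N² (1 + |M|) η` are at most `N² ε² / 8`, so that
  -- the sum is at most `(N ε / 2)²`.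
  set η := min ε (ε ^ 2 / (8 * (1 + |M|)))
  have hη : 0 < η := lt_min hε (by positivity)
  have hηM : (1 + |M|) * η ≤ ε ^ 2 / 8 := by
    calc (1 + |M|) * η ≤ (1 + |M|) * (ε ^ 2 / (8 * (1 + |M|))) := by
          gcongr; exact min_le_right _ _
      _ = ε ^ 2 / 8 := by field_simp
  obtain ⟨u, hu, hX⟩ := exists_approx_unit_seq I F' hη
  have hkey : ∀ f ∈ F', ‖∑ k ∈ Finset.range N, (1 - u k) * f * u k‖ ≤ N * (ε / 2) := fun f hf => by
    refine abs_le_of_sq_le_sq' ?_ (by positivity) |>.2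
    refine (norm_sum_sq_le (M := |M|) (η := (1 + |M|) * η) _ (fun k => ?_)
      fun k l hkl => (hX f hf k l hkl).trans ?_).trans ?_
    · calc _ ≤ ‖1 - u k‖ * ‖f‖ * ‖u k‖ := norm_mul₃_le
        _ ≤ 1 * |M| * 1 := by
          gcongr
          · exact norm_one_sub_le_one (hu k).2.1 (hu k).2.2.1
          · exact (hM f hf).trans (le_abs_self M)
          · exact norm_le_one_of_nonneg_of_le_one (hu k).2.1 (hu k).2.2.1
        _ = |M| := by ring
    · gcongr
      exact (hM f hf).trans (le_abs_self M)
    · rw [sq_abs]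
      nlinarith [mul_le_mul_of_nonneg_left hNM hN0.le,
        mul_le_mul_of_nonneg_left hηM (sq_nonneg (N : ℝ))]
  set w : B := ((N : ℝ)⁻¹) • ∑ k ∈ Finset.range N, u k with hw
  have hwI : w ∈ I := by
    rw [hw, ← one_mul (∑ k ∈ Finset.range N, u k), ← smul_mul_assoc]
    exact I.mul_mem_left _ (sum_mem fun k _ => (hu k).1)
  have hNinv : (0 : ℝ) ≤ (N : ℝ)⁻¹ := by positivity
  have hone : ∀ b : B, b = ((N : ℝ)⁻¹) • ∑ k ∈ Finset.range N, b := fun b => by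
    rw [Finset.sum_const, Finset.card_range, ← Nat.cast_smul_eq_nsmul ℝ, smul_smul,
      inv_mul_cancel₀ hN0.ne', one_smul]
  refine ⟨w, hwI, smul_nonneg hNinv (Finset.sum_nonneg fun k _ => (hu k).2.1), ?_, fun f hf => ?_,
    fun h hh hhI => ?_⟩
  · rw [hone 1]
    exact smul_le_smul_of_nonneg_left (Finset.sum_le_sum fun k _ => (hu k).2.2.1) hNinv
  · have e : w * f - f * w = ((N : ℝ)⁻¹) •
        (star (∑ k ∈ Finset.range N, (1 - u k) * star f * u k) -
          ∑ k ∈ Finset.range N, (1 - u k) * f * u k) := by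
      rw [hw, smul_mul_assoc, mul_smul_comm, ← smul_sub, Finset.sum_mul, Finset.mul_sum,
        ← Finset.sum_sub_distrib, star_sum, ← Finset.sum_sub_distrib]
      congr 1
      refine Finset.sum_congr rfl fun k _ => ?_
      simp only [star_mul, star_sub, star_one, star_star, (hu k).2.1.isSelfAdjoint.star_eq]
      noncomm_ring
    have h1 := hkey f (Finset.mem_union_left _ hf)
    have h2 := hkey (star f) (Finset.mem_union_right _ (Finset.mem_image_of_mem _ hf))
    rw [e, norm_smul, Real.norm_of_nonneg hNinv, inv_mul_le_iff₀ hN0]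
    refine (norm_sub_le _ _).trans ?_
    rw [norm_star]
    linarith
  · have e : h - h * w = ((N : ℝ)⁻¹) • ∑ k ∈ Finset.range N, (h - h * u k) := by
      rw [Finset.sum_sub_distrib, smul_sub, ← hone, hw, mul_smul_comm, Finset.mul_sum]
    rw [e, norm_smul, Real.norm_of_nonneg hNinv, inv_mul_le_iff₀ hN0]
    calc _ ≤ ∑ k ∈ Finset.range N, ε := norm_sum_le_of_le _ fun k _ =>
          ((hu k).2.2.2 h (Finset.mem_union_left _ hh) hhI).trans (min_le_left _ _)
      _ = N * ε := by simp

/-- Quasi-central approximate units exist in all ideals. -/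
lemma exists_quasicentral_approx_unit (I : Ideal B) [I.IsTwoSided] :
    ∃ l : Filter B, l.NeBot ∧ (∀ᶠ u in l, u ∈ I ∧ 0 ≤ u ∧ u ≤ 1) ∧
      (∀ b : B, Tendsto (fun u => u * b - b * u) l (𝓝 0)) ∧
      ∀ h ∈ I, Tendsto (fun u => h * (1 - u)) l (𝓝 0) := by
  classical
  choose U hUI hU0 hU1 hUc hU using fun q : Finset B × ℕ =>
    exists_quasicentral I q.1 (Nat.one_div_pos_of_nat (α := ℝ) (n := q.2))
  have hev : ∀ (b : B) {ε : ℝ}, 0 < ε →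
      ∀ᶠ q : Finset B × ℕ in atTop, b ∈ q.1 ∧ 1 / ((q.2 : ℝ) + 1) < ε := fun b ε hε => by
    obtain ⟨n, hn⟩ := exists_nat_one_div_lt hε
    filter_upwards [eventually_ge_atTop (({b}, n) : Finset B × ℕ)] with q hq
    refine ⟨hq.1 (Finset.mem_singleton_self b), (Nat.one_div_le_one_div hq.2).trans_lt hn⟩
  refine ⟨map U atTop, inferInstance, eventually_map.2 (.of_forall fun q => ⟨hUI q, hU0 q, hU1 q⟩),
    fun b => ?_, fun h hh => ?_⟩ <;>
  · rw [tendsto_map'_iff, Metric.tendsto_nhds]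
    intro ε hε
    first
    | filter_upwards [hev b hε] with q hq
      rw [dist_zero_right]
      exact (hUc q b hq.1).trans_lt hq.2
    | filter_upwards [hev h hε] with q hq
      rw [dist_zero_right]
      simpa only [Function.comp, mul_sub, mul_one] using (hU q h hq.1 hh).trans_lt hq.2

end ApproximateUnits

/-! ### Akemann–Pedersen norm reduction. -/

section NormReduction

variable {B : Type u} [CStarAlgebra B] [PartialOrder B] [StarOrderedRing B]

/-- Conjugate `s ≤ M` by `s^{1/2}`; no commutativity beyond that of `s` with its root is involved.
-/
lemma mul_self_le_smul {s : B} {M : ℝ} (hs : 0 ≤ s) (hM : ‖s‖ ≤ M) : s * s ≤ M • s := by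
  have h0 : star (CFC.sqrt s) = CFC.sqrt s := (CFC.sqrt_nonneg s).isSelfAdjoint.star_eq
  have h1 : s ≤ algebraMap ℝ B M :=
    (CStarAlgebra.norm_le_iff_le_algebraMap s ((norm_nonneg s).trans hM)).1 hM
  have h2 := star_left_conjugate_le_conjugate h1 (CFC.sqrt s)
  have h3 : CFC.sqrt s * CFC.sqrt s = s := CFC.sqrt_mul_sqrt_self s
  rw [h0, Algebra.algebraMap_eq_smul_one, mul_smul_comm, mul_one, smul_mul_assoc, h3] at h2
  have h4 : CFC.sqrt s * s * CFC.sqrt s = s * s := by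
    calc CFC.sqrt s * s * CFC.sqrt s
        = CFC.sqrt s * (CFC.sqrt s * CFC.sqrt s) * CFC.sqrt s := by rw [h3]
      _ = (CFC.sqrt s * CFC.sqrt s) * (CFC.sqrt s * CFC.sqrt s) := by simp only [mul_assoc]
      _ = s * s := by rw [h3]
  rwa [h4] at h2

lemma sq_le_one_of_nonneg_of_le_one {m : B} (h0 : 0 ≤ m) (h1 : m ≤ 1) : m ^ 2 ≤ 1 := by
  have h := mul_self_le_smul h0 (norm_le_one_of_nonneg_of_le_one h0 h1)
  rw [one_smul, ← sq] at h
  exact h.trans h1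

/-- The norm of a sum of two almost orthogonal positive elements. -/
lemma norm_add_sq_le {s t : B} {M ε : ℝ} (hs : 0 ≤ s) (ht : 0 ≤ t) (hsM : ‖s‖ ≤ M)
    (htM : ‖t‖ ≤ M) (hst : ‖s * t‖ ≤ ε) : ‖s + t‖ ^ 2 ≤ M * ‖s + t‖ + 2 * ε := by
  have hM : 0 ≤ M := (norm_nonneg s).trans hsM
  have hsa : IsSelfAdjoint (s + t) := (add_nonneg hs ht).isSelfAdjoint
  have hss : 0 ≤ s * s := by
    simpa only [hs.isSelfAdjoint.star_eq] using star_mul_self_nonneg s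
  have htt : 0 ≤ t * t := by
    simpa only [ht.isSelfAdjoint.star_eq] using star_mul_self_nonneg t
  have h1 : ‖s * s + t * t‖ ≤ M * ‖s + t‖ := by
    have : s * s + t * t ≤ M • (s + t) := by
      rw [smul_add]; exact add_le_add (mul_self_le_smul hs hsM) (mul_self_le_smul ht htM)
    refine (CStarAlgebra.norm_le_norm_of_nonneg_of_le (add_nonneg hss htt) this).trans ?_
    rw [norm_smul, Real.norm_of_nonneg hM]
  have h2 : ‖t * s‖ ≤ ε := by
    rw [← norm_star, star_mul, hs.isSelfAdjoint.star_eq, ht.isSelfAdjoint.star_eq]; exact hst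
  have e : star (s + t) * (s + t) = (s * s + t * t) + (s * t + t * s) := by
    rw [hsa.star_eq]; noncomm_ring
  rw [sq, ← CStarRing.norm_star_mul_self, e]
  refine (norm_add_le _ _).trans (add_le_add h1 ?_)
  refine (norm_add_le _ _).trans ?_
  linarith

/-- Akemann and Pedersen's norm reduction: multiplying by `(1 - δ) + δ v`, where `v` almost
annihilates `i`. -/
lemma norm_mul_sq_le {a i v : B} {C R δ κ : ℝ} (hi : 0 ≤ i)
    (ha : star a * a ≤ algebraMap ℝ B (C ^ 2) + i) (hiR : ‖i‖ ≤ R ^ 2 - C ^ 2)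
    (hR : 0 ≤ R) (hδ0 : 0 ≤ δ) (hδ1 : δ ≤ 1) (hRC : (1 - δ) * R ≤ C)
    (hv0 : 0 ≤ v) (hv1 : v ≤ 1) (hiv : ‖i * v‖ ≤ κ) :
    ‖a * ((1 - δ) • 1 + δ • v)‖ ^ 2 ≤ C ^ 2 + √(2 * (C ^ 2 * κ)) + κ := by
  have hκ : 0 ≤ κ := (norm_nonneg _).trans hiv
  have hδ' : 0 ≤ 1 - δ := sub_nonneg.2 hδ1
  have hvn : ‖v‖ ≤ 1 := norm_le_one_of_nonneg_of_le_one hv0 hv1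
  have hvs : star v = v := hv0.isSelfAdjoint.star_eq
  have hvi : ‖v * i‖ ≤ κ := by
    rw [← norm_star, star_mul, hvs, hi.isSelfAdjoint.star_eq]; exact hiv
  have hvv : 0 ≤ v * v := by simpa only [hvs] using star_mul_self_nonneg v
  set w : B := (1 - δ) • 1 + δ • v with hw
  have hws : star w = w := by simp [hw, hvs]
  -- `q = w² - (1 - δ)²`. Each term contains `v`, so `q` almost annihilates `i`. Up to small terms
  -- `w (C² + i) w` is thus `C² (1 - δ)²` plus two almost orthogonal positive elements, `C² q` and
  -- `(1 - δ)² i`, each of norm at most `M`; and `C² (1 - δ)² + M = C²`.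
  set q : B := (2 * δ * (1 - δ)) • v + δ ^ 2 • (v * v) with hq
  have hq0 : 0 ≤ q := add_nonneg (smul_nonneg (by positivity) hv0) (smul_nonneg (by positivity) hvv)
  have hcoef : ∀ x : ℝ, 0 ≤ x →
      (2 * δ * (1 - δ)) * x + δ ^ 2 * x = (1 - (1 - δ) ^ 2) * x := fun x hx => by ring
  have hqn : ∀ c : B, ∀ x : ℝ, 0 ≤ x → ‖v * c‖ ≤ x → ‖q * c‖ ≤ (1 - (1 - δ) ^ 2) * x :=
      fun c x hx hc => by
    have h2 : ‖v * (v * c)‖ ≤ x := by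
      refine (norm_mul_le _ _).trans ?_
      nlinarith [norm_nonneg v, norm_nonneg (v * c)]
    rw [← hcoef x hx, hq, add_mul, smul_mul_assoc, smul_mul_assoc, mul_assoc]
    refine (norm_add_le _ _).trans (add_le_add ?_ ?_)
    · rw [norm_smul, Real.norm_of_nonneg (by positivity)]; gcongr
    · rw [norm_smul, Real.norm_of_nonneg (by positivity), mul_assoc]; gcongr
  have hww : w * w = (1 - δ) ^ 2 • 1 + q := by
    simp only [hw, hq, add_mul, mul_add, smul_mul_assoc, mul_smul_comm, one_mul, mul_one]
    module
  have hwiw : w * i * w = (1 - δ) ^ 2 • i +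
      ((δ * (1 - δ)) • (v * i) + (δ * (1 - δ)) • (i * v) + δ ^ 2 • (v * (i * v))) := by
    simp only [hw, add_mul, mul_add, smul_mul_assoc, mul_smul_comm, one_mul, mul_one, mul_assoc]
    module
  set M := C ^ 2 * (1 - (1 - δ) ^ 2) with hM
  have h1δ : 0 ≤ 1 - (1 - δ) ^ 2 := by nlinarith
  have h1δ' : 1 - (1 - δ) ^ 2 ≤ 1 := by nlinarith
  have hM0 : 0 ≤ M := by positivity
  set s : B := C ^ 2 • q
  set t : B := (1 - δ) ^ 2 • i
  have hs : 0 ≤ s := smul_nonneg (by positivity) hq0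
  have ht : 0 ≤ t := smul_nonneg (by positivity) hi
  have hsM : ‖s‖ ≤ M := by
    rw [norm_smul, Real.norm_of_nonneg (by positivity)]
    have := hqn 1 1 zero_le_one (by rwa [mul_one])
    rw [mul_one, mul_one] at this
    exact mul_le_mul_of_nonneg_left this (by positivity)
  have htM : ‖t‖ ≤ M := by
    rw [norm_smul, Real.norm_of_nonneg (by positivity)]
    -- `(1 - δ)² (R² - C²) ≤ C² - (1 - δ)² C² = M`, by `(1 - δ) R ≤ C`.
    have h1 := mul_le_mul_of_nonneg_left hiR (sq_nonneg (1 - δ))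
    have h2 : ((1 - δ) * R) ^ 2 ≤ C ^ 2 := pow_le_pow_left₀ (by positivity) hRC 2
    rw [hM]
    nlinarith
  have hst : ‖s * t‖ ≤ C ^ 2 * κ := by
    have h1 := hqn i κ hκ hvi
    rw [show s * t = (C ^ 2 * (1 - δ) ^ 2) • (q * i) by
      simp only [s, t, smul_mul_assoc, mul_smul_comm, smul_smul]; rw [mul_comm], norm_smul,
      Real.norm_of_nonneg (by positivity)]
    calc C ^ 2 * (1 - δ) ^ 2 * ‖q * i‖ ≤ C ^ 2 * 1 * (1 * κ) := by
          gcongr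
          · linarith
          · exact h1.trans (by gcongr)
      _ = C ^ 2 * κ := by ring
  have hN : ‖s + t‖ ≤ M + √(2 * (C ^ 2 * κ)) := by
    have h1 := norm_add_sq_le hs ht hsM htM hst
    have h2 := Real.sq_sqrt (show 0 ≤ 2 * (C ^ 2 * κ) by positivity)
    have h3 := Real.sqrt_nonneg (2 * (C ^ 2 * κ))
    -- With `X = ‖s + t‖`, the bound `X² ≤ M X + 2 C² κ` fails as soon as `X > M + √(2 C² κ)`.
    by_contra! h
    nlinarith
  have herr : ‖(δ * (1 - δ)) • (v * i) + (δ * (1 - δ)) • (i * v) + δ ^ 2 • (v * (i * v))‖ ≤ κ := by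
    have h3 : ‖v * (i * v)‖ ≤ κ := by
      refine (norm_mul_le _ _).trans ?_
      nlinarith [norm_nonneg v, norm_nonneg (i * v)]
    have hd : 0 ≤ δ * (1 - δ) := by positivity
    refine (norm_add₃_le).trans ?_
    rw [norm_smul, norm_smul, norm_smul, Real.norm_of_nonneg hd,
      Real.norm_of_nonneg (sq_nonneg δ)]
    calc _ ≤ δ * (1 - δ) * κ + δ * (1 - δ) * κ + δ ^ 2 * κ := by gcongr
      _ = (1 - (1 - δ) ^ 2) * κ := by ring
      _ ≤ 1 * κ := by gcongr
      _ = κ := one_mul κ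
  have hmain : star (a * w) * (a * w) ≤ (C ^ 2 * (1 - δ) ^ 2) • 1 + ((s + t) +
      ((δ * (1 - δ)) • (v * i) + (δ * (1 - δ)) • (i * v) + δ ^ 2 • (v * (i * v)))) := by
    have h := star_left_conjugate_le_conjugate ha w
    rw [hws] at h
    have e : star (a * w) * (a * w) = w * (star a * a) * w := by
      rw [star_mul, hws]; simp only [mul_assoc]
    rw [e]
    refine h.trans_eq ?_
    rw [mul_add w, add_mul _ _ w, hwiw, Algebra.algebraMap_eq_smul_one, mul_smul_comm, smul_mul_assoc,
      mul_one, hww, smul_add, smul_smul]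
    simp only [s, t]
    abel
  rw [sq, ← CStarRing.norm_star_mul_self]
  refine (CStarAlgebra.norm_le_norm_of_nonneg_of_le (star_mul_self_nonneg _) hmain).trans ?_
  refine (norm_add_le _ _).trans ?_
  have hone : ‖((C ^ 2 * (1 - δ) ^ 2) • 1 : B)‖ ≤ C ^ 2 * (1 - δ) ^ 2 := by
    rw [norm_smul, Real.norm_of_nonneg (by positivity)]
    refine mul_le_of_le_one_right (by positivity) ?_
    exact norm_le_one_of_nonneg_of_le_one zero_le_one le_rfl
  have h := (norm_add_le _ _).trans (add_le_add hN herr)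
  calc _ ≤ C ^ 2 * (1 - δ) ^ 2 + (M + √(2 * (C ^ 2 * κ)) + κ) := add_le_add hone h
    _ = _ := by rw [hM]; ring

/-- Asymptotic norm reduction along an approximate unit. -/
lemma eventually_norm_mul_le {I : Ideal B} {l : Filter B}
    (hl : ∀ᶠ u in l, u ∈ I ∧ 0 ≤ u ∧ u ≤ 1)
    (hlI : ∀ h ∈ I, Tendsto (fun u => h * (1 - u)) l (𝓝 0))
    {a i : B} {C R δ : ℝ} (hiI : i ∈ I) (hi : 0 ≤ i)
    (ha : star a * a ≤ algebraMap ℝ B (C ^ 2) + i) (hiR : ‖i‖ ≤ R ^ 2 - C ^ 2) (hC : 0 ≤ C)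
    (hR : 0 ≤ R) (hδ0 : 0 ≤ δ) (hδ1 : δ ≤ 1) (hRC : (1 - δ) * R ≤ C) {η : ℝ} (hη : 0 < η) :
    ∀ᶠ u in l, ‖a * (1 - δ • u)‖ ≤ C + η := by
  have hf : Tendsto (fun κ : ℝ => C ^ 2 + √(2 * (C ^ 2 * κ)) + κ) (𝓝 0) (𝓝 (C ^ 2)) := by
    have : Continuous fun κ : ℝ => C ^ 2 + √(2 * (C ^ 2 * κ)) + κ := by fun_prop
    simpa using this.tendsto 0
  have h0 : Tendsto (fun u => ‖i * (1 - u)‖) l (𝓝 0) := by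
    simpa using (hlI i hiI).norm
  have hlt : C ^ 2 < (C + η) ^ 2 := by nlinarith
  filter_upwards [hl, (hf.comp h0).eventually_lt_const hlt] with u hu hu2
  have h := norm_mul_sq_le hi ha hiR hR hδ0 hδ1 hRC (sub_nonneg.2 hu.2.2)
    (sub_le_self _ hu.2.1) (le_refl ‖i * (1 - u)‖)
  have e : (1 - δ) • (1 : B) + δ • (1 - u) = 1 - δ • u := by module
  rw [e] at h
  exact abs_le_of_sq_le_sq' (h.trans hu2.le) (by positivity) |>.2

end NormReduction

/-! ### Words and polynomials in asymptotically rescaled letters. -/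

section AsymptoticEvaluation

variable {α L : Type*} {B : Type u} [CStarAlgebra B] {l : Filter α}

/-- If letters are asymptotically multiplied by a power of an asymptotically central `W`, so are
words. -/
lemma tendsto_word_sub {W : α → B} (hW : ∀ᶠ u in l, ‖W u‖ ≤ 1)
    (hWc : ∀ b : B, Tendsto (fun u => W u * b - b * W u) l (𝓝 0))
    {c : L → B} {c' : α → L → B} (deg : L → ℕ)
    (hc : ∀ x, Tendsto (fun u => c' u x - c x * W u ^ deg x) l (𝓝 0)) (w : List L) :
    Tendsto (fun u => (w.map (c' u)).prod - (w.map c).prod * W u ^ (w.map deg).sum) l (𝓝 0) := by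
  have hWb : ∀ n : ℕ, IsBoundedUnder (· ≤ ·) l (norm ∘ fun u => W u ^ n) := by
    refine fun n => ⟨‖(1 : B)‖, eventually_map.2 ?_⟩
    filter_upwards [hW] with u hu
    induction n with
    | zero => simp
    | succ n ih =>
      rw [Function.comp, pow_succ]
      exact (norm_mul_le _ _).trans ((mul_le_of_le_one_right (norm_nonneg _) hu).trans ih)
  have hWc' : ∀ (n : ℕ) (b : B), Tendsto (fun u => W u ^ n * b - b * W u ^ n) l (𝓝 0) := by
    intro n b
    induction n with
    | zero => simpa using tendsto_const_nhds
    | succ n ih =>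
      have h := (isBoundedUnder_le_mul_tendsto_zero (hWb n) (hWc b)).add
        (ih.zero_mul_isBoundedUnder_le (g := W) (by simpa using hWb 1))
      rw [add_zero] at h
      refine h.congr fun u => ?_
      rw [pow_succ]
      noncomm_ring
  induction w with
  | nil => simpa using tendsto_const_nhds
  | cons x w ih =>
    set n := (w.map deg).sum
    set V := (w.map c).prod
    have hcm : ∀ b : B, Tendsto (fun _ : α => b) l (𝓝 b) := fun b => tendsto_const_nhds
    -- The difference telescopes into four terms: error times error, error in the tail, error in the
    -- first letter, and the commutator moving `W ^ deg x` past `V`. Separating the first term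
    -- avoids a bound on `c'`.
    have h1 := (hc x).mul ih
    have h2 := (hcm (c x)).mul (isBoundedUnder_le_mul_tendsto_zero (hWb (deg x)) ih)
    have h3 : Tendsto (fun u => (c' u x - c x * W u ^ deg x) * V * W u ^ n) l (𝓝 0) :=
      Tendsto.zero_mul_isBoundedUnder_le (by simpa using (hc x).mul (hcm V)) (hWb n)
    have h4 := (hcm (c x)).mul ((hWc' (deg x) V).zero_mul_isBoundedUnder_le (hWb n))
    have h := ((h1.add h2).add h3).add h4
    simp only [mul_zero, add_zero] at h
    refine h.congr fun u => ?_
    simp only [List.map_cons, List.prod_cons, List.sum_cons, pow_add]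
    noncomm_ring

/-- Asymptotic evaluation of linear combinations of words of the same degree. -/
lemma tendsto_lift_sub {W : α → B} (hW : ∀ᶠ u in l, ‖W u‖ ≤ 1)
    (hWc : ∀ b : B, Tendsto (fun u => W u * b - b * W u) l (𝓝 0))
    {c : L → B} {c' : α → L → B} (deg : L → ℕ)
    (hc : ∀ x, Tendsto (fun u => c' u x - c x * W u ^ deg x) l (𝓝 0)) {d : ℕ}
    {p : FreeAlgebra ℂ L}
    (hp : p ∈ Submodule.span ℂ {q | ∃ w : List L, (w.map deg).sum = d ∧
      q = (w.map (FreeAlgebra.ι ℂ)).prod}) :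
    Tendsto (fun u => FreeAlgebra.lift ℂ (c' u) p - FreeAlgebra.lift ℂ c p * W u ^ d) l (𝓝 0) := by
  induction hp using Submodule.span_induction with
  | mem q hq =>
    obtain ⟨w, rfl, rfl⟩ := hq
    simpa [map_list_prod, Function.comp_def] using tendsto_word_sub hW hWc deg hc w
  | zero => simpa using tendsto_const_nhds
  | add p q _ _ h1 h2 =>
    convert h1.add h2 using 2 with u
    · simp only [map_add, add_mul]; abel
    · simp
  | smul a p _ h =>
    convert h.const_smul a using 2 with u
    · simp only [map_smul, smul_mul_assoc, smul_sub]
    · simp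

lemma tendsto_lift {c : L → B} {c' : α → L → B} (hc : ∀ x, Tendsto (fun u => c' u x) l (𝓝 (c x)))
    (p : FreeAlgebra ℂ L) :
    Tendsto (fun u => FreeAlgebra.lift ℂ (c' u) p) l (𝓝 (FreeAlgebra.lift ℂ c p)) := by
  induction p using FreeAlgebra.induction with
  | grade0 r => simpa only [AlgHom.commutes] using tendsto_const_nhds
  | grade1 x => simpa using hc x
  | mul p q h1 h2 => simpa only [map_mul] using h1.mul h2
  | add p q h1 h2 => simpa only [map_add] using h1.add h2

end AsymptoticEvaluation

/-! ### Homogeneous polynomials as combinations of words of fixed degree. -/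

section Homogeneous

namespace FreeAlgebra

lemma basisFreeMonoid_apply {R X : Type*} [CommSemiring R] (w : FreeMonoid X) :
    basisFreeMonoid R X w = (w.toList.map (ι R)).prod := by
  simp [basisFreeMonoid, equivMonoidAlgebraFreeMonoid, MonoidAlgebra.lift_apply, FreeMonoid.lift_apply]

end FreeAlgebra

namespace NCStarPoly

/-- The degree of a letter in the variables `𝐱`. -/
def xDegree {r : ℕ} : StarLetter (MixedVar r) → ℕ
  | .var (.inl _) => 1
  | .adj (.inl _) => 1
  | .var (.inr _) => 0
  | .adj (.inr _) => 0

lemma scaleX_word {r : ℕ} (t : ℝ) (w : List (StarLetter (MixedVar r))) :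
    scaleX t (w.map (FreeAlgebra.ι ℂ)).prod =
      (t : ℂ) ^ (w.map xDegree).sum • (w.map (FreeAlgebra.ι ℂ)).prod := by
  induction w with
  | nil => simp
  | cons x w ih =>
    have hx : scaleX t (FreeAlgebra.ι ℂ x) = (t : ℂ) ^ xDegree x • FreeAlgebra.ι ℂ x := by
      rcases x with (k | k) | (k | k) <;> simp [scaleX, xDegree]
    simp only [List.map_cons, List.prod_cons, List.sum_cons, map_mul, ih, hx, pow_add,
      smul_mul_smul_comm]

/-- Scaling by `2` is diagonal in the basis of words, with eigenvalue `2 ^ degree`. Different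
degrees have different eigenvalues, so an eigenvector for `2 ^ d` involves only words of degree `d`.
-/
lemma IsHomogeneousInX.mem_span {r : ℕ} {p : NCStarPoly (MixedVar r)} {d : ℕ}
    (hp : p.IsHomogeneousInX d) :
    p ∈ Submodule.span ℂ {q | ∃ w : List (StarLetter (MixedVar r)), (w.map xDegree).sum = d ∧
      q = (w.map (FreeAlgebra.ι ℂ)).prod} := by
  set b := FreeAlgebra.basisFreeMonoid ℂ (StarLetter (MixedVar r)) with hb
  have hscale : ∀ w q, b.repr (scaleX 2 q) w = (2 : ℂ) ^ (w.toList.map xDegree).sum * b.repr q w := by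
    intro w q
    have : (b.coord w) ∘ₗ (scaleX 2).toLinearMap =
        (2 : ℂ) ^ (w.toList.map xDegree).sum • b.coord w := by
      refine b.ext fun v => ?_
      have h1 : scaleX 2 (b v) = (2 : ℂ) ^ (v.toList.map xDegree).sum • b v := by
        rw [hb, FreeAlgebra.basisFreeMonoid_apply, scaleX_word]; norm_num
      simp only [LinearMap.comp_apply, AlgHom.toLinearMap_apply, h1, map_smul,
        LinearMap.smul_apply, Module.Basis.coord_apply, Module.Basis.repr_self, smul_eq_mul]
      rcases eq_or_ne v w with rfl | h
      · rfl
      · simp [Finsupp.single_eq_of_ne h.symm]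
    simpa using LinearMap.congr_fun this q
  rw [← b.linearCombination_repr p, Finsupp.linearCombination_apply]
  refine sum_mem fun w hw => Submodule.smul_mem _ _ (Submodule.subset_span ⟨w.toList, ?_, ?_⟩)
  · have h := hscale w p
    rw [hp 2, map_smul, Finsupp.smul_apply, smul_eq_mul] at h
    have h2 := mul_right_cancel₀ (Finsupp.mem_support_iff.1 hw) h
    have h3 : (2 : ℕ) ^ d = 2 ^ (w.toList.map xDegree).sum := by
      have : (2 : ℂ) ^ d = 2 ^ (w.toList.map xDegree).sum := by simpa using h2
      exact_mod_cast this
    exact (Nat.pow_right_injective le_rfl h3).symm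
  · rw [hb, FreeAlgebra.basisFreeMonoid_apply]

/-- The values of the letters of ⋆-polynomials, in the unitization. -/
def letterValue {V : Type} {A : Type u} [NonUnitalCStarAlgebra A] (w : V → A) :
    StarLetter V → A⁺¹
  | .var v => ((w v : A) : A⁺¹)
  | .adj v => ((star (w v) : A) : A⁺¹)

lemma eval_eq_lift {V : Type} {A : Type u} [NonUnitalCStarAlgebra A] (w : V → A)
    (p : NCStarPoly V) : p.eval w = FreeAlgebra.lift ℂ (letterValue w) p := by
  unfold eval
  congr 2

/-- Polynomials that are homogeneous of positive degree have no constant term. -/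
lemma IsHomogeneousInX.fst_eval {r : ℕ} {p : NCStarPoly (MixedVar r)} {d : ℕ}
    (hp : p.IsHomogeneousInX d) (hd : 1 ≤ d) {A : Type u} [NonUnitalCStarAlgebra A]
    (w : MixedVar r → A) : (p.eval w).fst = 0 := by
  have h0 : ∀ w : List (StarLetter (MixedVar r)), 1 ≤ (w.map xDegree).sum → w ≠ [] := by
    rintro w hw rfl
    simp at hw
  rw [eval_eq_lift]
  have hmem := hp.mem_span
  clear hp
  induction hmem using Submodule.span_induction with
  | mem q hq =>
    obtain ⟨v, hv, rfl⟩ := hq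
    obtain ⟨x, v, rfl⟩ := List.exists_cons_of_ne_nil (h0 v (hv ▸ hd))
    have hx : (letterValue w x).fst = 0 := by cases x <;> rfl
    simp [hx]
  | zero => simp
  | add p q _ _ h1 h2 => simp [h1, h2]
  | smul a p _ h => simp [h]

lemma eval_comp {V : Type} {A A' : Type u} [NonUnitalCStarAlgebra A] [NonUnitalCStarAlgebra A']
    (φ : A →⋆ₙₐ[ℂ] A') (w : V → A) (p : NCStarPoly V) :
    p.eval (fun v => φ (w v)) = Unitization.starMap φ (p.eval w) := by
  rw [eval_eq_lift, eval_eq_lift]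
  have : FreeAlgebra.lift ℂ (letterValue fun v => φ (w v)) =
      ((Unitization.starMap φ : A⁺¹ →⋆ₐ[ℂ] A'⁺¹) : A⁺¹ →ₐ[ℂ] A'⁺¹).comp
        (FreeAlgebra.lift ℂ (letterValue w)) := by
    refine FreeAlgebra.hom_ext (funext fun x => ?_)
    cases x <;> simp [letterValue, map_star]
  exact DFunLike.congr_fun this p

end NCStarPoly

end Homogeneous

/-! ### The ideal inside the unitization, and lifting norm bounds from the quotient. -/

section UnitizationIdeal

namespace CStarIdeal

variable {A : Type u} [NonUnitalCStarAlgebra A] (I : CStarIdeal A)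

/-- An ideal of a C⋆-algebra, as an ideal of the unitization. -/
def unitizationIdeal : Ideal A⁺¹ where
  carrier := {b | ∃ i ∈ I.toSubmodule, b = (i : A⁺¹)}
  add_mem' := by
    rintro _ _ ⟨i, hi, rfl⟩ ⟨j, hj, rfl⟩
    exact ⟨i + j, add_mem hi hj, (Unitization.inr_add ..).symm⟩
  zero_mem' := ⟨0, zero_mem _, (Unitization.inr_zero _).symm⟩
  smul_mem' := by
    rintro c _ ⟨i, hi, rfl⟩
    refine ⟨c.fst • i + c.snd * i, add_mem (Submodule.smul_mem _ _ hi) (I.mul_mem_left _ hi), ?_⟩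
    ext <;> simp

lemma mem_unitizationIdeal {b : A⁺¹} :
    b ∈ I.unitizationIdeal ↔ ∃ i ∈ I.toSubmodule, b = (i : A⁺¹) := Iff.rfl

lemma inr_mem_unitizationIdeal {a : A} : (a : A⁺¹) ∈ I.unitizationIdeal ↔ a ∈ I.toSubmodule :=
  ⟨fun ⟨_, hi, h⟩ => Unitization.inr_injective h ▸ hi, fun h => ⟨a, h, rfl⟩⟩

instance : I.unitizationIdeal.IsTwoSided where
  mul_mem_of_left := by
    rintro _ c ⟨i, hi, rfl⟩
    refine ⟨c.fst • i + i * c.snd, add_mem (Submodule.smul_mem _ _ hi) (I.mul_mem_right _ hi), ?_⟩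
    ext <;> simp

lemma isClosed_unitizationIdeal : IsClosed (I.unitizationIdeal : Set A⁺¹) := by
  have h : (I.unitizationIdeal : Set A⁺¹) =
      (fun a : A => (a : A⁺¹)) '' (I.toSubmodule : Set A) := by
    ext b
    simp only [SetLike.mem_coe, mem_unitizationIdeal, Set.mem_image, eq_comm]
  rw [h]
  exact (Unitization.isometry_inr (𝕜 := ℂ) (A := A)).isClosedEmbedding.isClosedMap _ I.isClosed

lemma π_eq_π {a b : A} : I.π a = I.π b ↔ (a : A⁺¹) - b ∈ I.unitizationIdeal := by
  rw [← Unitization.inr_sub, inr_mem_unitizationIdeal]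
  exact Quotient.mk_eq_mk I

lemma π_eq_zero {a : A} : I.π a = 0 ↔ a ∈ I.toSubmodule := by
  rw [← map_zero I.π, π_eq_π, ← Unitization.inr_sub, inr_mem_unitizationIdeal, sub_zero]

/-- If `π a` has norm at most `C` then `a⋆ a` exceeds `C ^ 2` only by an element of the ideal. -/
lemma exists_star_mul_self_le {a : A} {C : ℝ} (ha : ‖I.π a‖ ≤ C) :
    ∃ i ∈ I.unitizationIdeal, 0 ≤ i ∧
      star (a : A⁺¹) * (a : A⁺¹) ≤ algebraMap ℝ A⁺¹ (C ^ 2) + i ∧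
      ∀ R, ‖a‖ ≤ R → C ≤ R → ‖i‖ ≤ R ^ 2 - C ^ 2 := by
  have hC : 0 ≤ C := (norm_nonneg _).trans ha
  -- The element `i` is the positive part `(a⋆ a - C²)₊`. It stays in `A` because `f 0 = 0`, and
  -- lies in `I` because `π` maps it to `(π(a)⋆ π(a) - C²)₊ = 0`.
  set f : ℝ → ℝ := fun t => max (t - C ^ 2) 0 with hf
  have hf0 : f 0 = 0 := by simp [hf, sq_nonneg]
  have hfc : Continuous f := by fun_prop
  have hsa : IsSelfAdjoint (star a * a) := IsSelfAdjoint.star_mul_self a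
  have hπ : I.π (cfcₙ f (star a * a)) = 0 := by
    have hcont : Continuous I.π := continuous_quot_mk
    rw [NonUnitalStarAlgHomClass.map_cfcₙ (S := ℂ) I.π f (star a * a) hfc.continuousOn hf0 hcont hsa
      (hsa.map I.π)]
    rw [← cfcₙ_const_zero ℝ (I.π (star a * a))]
    refine cfcₙ_congr fun t ht => max_eq_right ?_
    have h1 : ‖t‖ ≤ ‖I.π (star a * a)‖ := 
      NonUnitalIsometricContinuousFunctionalCalculus.norm_quasispectrum_le _ ht (hsa.map I.π)
    rw [map_mul, map_star, CStarRing.norm_star_mul_self] at h1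
    nlinarith [le_abs_self t, Real.norm_eq_abs t, norm_nonneg (I.π a)]
  have hcoe : ((cfcₙ f (star a * a) : A) : A⁺¹) = cfc f ((star a * a : A) : A⁺¹) :=
    Unitization.real_cfcₙ_eq_cfc_inr _ _ hf0
  have hsa' : IsSelfAdjoint ((star a * a : A) : A⁺¹) := hsa.inr ℂ
  refine ⟨(cfcₙ f (star a * a) : A), I.inr_mem_unitizationIdeal.2 (I.π_eq_zero.1 hπ), ?_, ?_,
    fun R hR hCR => ?_⟩
  · rw [hcoe]
    exact cfc_nonneg fun t _ => le_max_right _ _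
  · rw [hcoe, ← Unitization.inr_star, ← Unitization.inr_mul]
    nth_rw 1 [← cfc_id' ℝ ((star a * a : A) : A⁺¹)]
    rw [← cfc_const_add (C ^ 2) f _ hfc.continuousOn]
    refine cfc_mono fun t _ => ?_
    linarith [le_max_left (t - C ^ 2) 0]
  · have hCR2 : C ^ 2 ≤ R ^ 2 := pow_le_pow_left₀ hC hCR 2
    rw [hcoe]
    refine norm_cfc_le (sub_nonneg.2 hCR2) fun t ht => ?_
    have h1 : ‖t‖ ≤ ‖((star a * a : A) : A⁺¹)‖ := spectrum.norm_le_norm_of_mem ht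
    rw [Unitization.norm_inr, CStarRing.norm_star_mul_self] at h1
    rw [Real.norm_of_nonneg (le_max_right _ _)]
    refine max_le ?_ (sub_nonneg.2 hCR2)
    nlinarith [le_abs_self t, Real.norm_eq_abs t, norm_nonneg a]

end CStarIdeal

end UnitizationIdeal

/-! ### Adjusting variables by a multiplier. -/

section Adjust

namespace VarKind

variable {A : Type u} [NonUnitalCStarAlgebra A] [PartialOrder A] [StarOrderedRing A]

lemma fst_adjust (m : A⁺¹) (x : A) (κ : VarKind) : (κ.adjust m x).fst = 0 := by
  cases κ <;> simp [adjust]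

lemma inr_snd_adjust (m : A⁺¹) (x : A) (κ : VarKind) :
    (((κ.adjust m x).snd : A) : A⁺¹) = κ.adjust m x := by
  ext
  · simp [fst_adjust]
  · simp

lemma adjust_one {D E F G : ℝ} {x : A} {κ : VarKind} (hx : κ.Restriction D E F G x) :
    κ.adjust 1 x = x := by
  cases κ with
  | pos =>
    simp only [adjust, one_pow, mul_one]
    rw [← Unitization.inr_mul, CFC.sqrt_mul_sqrt_self x hx.1]
  | herm => simp [adjust]
  | gen => simp [adjust]

lemma adjust_sub_mem {I : CStarIdeal A} {D E F G : ℝ} {x : A} {κ : VarKind}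
    (hx : κ.Restriction D E F G x) {m : A⁺¹} (hm : m - 1 ∈ I.unitizationIdeal) :
    κ.adjust m x - x ∈ I.unitizationIdeal := by
  have hm2 : m ^ 2 - 1 ∈ I.unitizationIdeal := by
    have : m ^ 2 - 1 = (m + 1) * (m - 1) := by noncomm_ring
    rw [this]; exact Ideal.mul_mem_left _ _ hm
  rw [← adjust_one hx]
  cases κ with
  | pos =>
    simp only [adjust, ← mul_sub, ← sub_mul, one_pow]
    exact Ideal.mul_mem_right _ _ (Ideal.mul_mem_left _ _ hm2)
  | herm =>
    have : m * (x : A⁺¹) * m - 1 * x * 1 = (m - 1) * (x * m) + x * (m - 1) := by noncomm_ring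
    simp only [adjust]
    rw [this]
    exact add_mem (Ideal.mul_mem_right _ _ hm) (Ideal.mul_mem_left _ _ hm)
  | gen =>
    simp only [adjust, ← mul_sub, one_pow]
    exact Ideal.mul_mem_left _ _ hm2

/-- Everything follows from `m² ≤ 1`: conjugation by `x^{1/2}` gives `z ≤ x` in the positive case,
and `-E m² ≤ m x m ≤ F m²` in the hermitian case, where the signs of `E` and `F` allow `m²` to be
replaced by `1`. -/
lemma Restriction.of_eq_adjust {D E F G : ℝ} (hE : 0 ≤ E) (hF : 0 ≤ F) {x z : A} {κ : VarKind}
    (hx : κ.Restriction D E F G x) {m : A⁺¹} (h0 : 0 ≤ m) (h1 : m ≤ 1)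
    (hz : (z : A⁺¹) = κ.adjust m x) : κ.Restriction D E F G z := by
  have hms : star m = m := h0.isSelfAdjoint.star_eq
  have hm2 : m ^ 2 ≤ 1 := sq_le_one_of_nonneg_of_le_one h0 h1
  have hm20 : 0 ≤ m ^ 2 := by
    simpa only [hms, ← sq] using star_mul_self_nonneg m
  have hconj : ∀ c : ℝ, m * algebraMap ℂ A⁺¹ c * m = c • m ^ 2 := fun c => by
    rw [Algebra.algebraMap_eq_smul_one, mul_smul_comm, mul_one, smul_mul_assoc, ← sq]
    exact Complex.coe_smul c _
  have hle : ∀ c : ℝ, 0 ≤ c → c • m ^ 2 ≤ algebraMap ℂ A⁺¹ c := fun c hc => by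
    rw [Algebra.algebraMap_eq_smul_one]
    exact (smul_le_smul_of_nonneg_left hm2 hc).trans_eq (Complex.coe_smul c _).symm
  cases κ with
  | pos =>
    set q : A⁺¹ := ((CFC.sqrt x : A) : A⁺¹) with hq
    have hqs : star q = q := by
      rw [hq, ← Unitization.inr_star, (CFC.sqrt_nonneg x).isSelfAdjoint.star_eq]
    have hqq : q * q = x := by rw [hq, ← Unitization.inr_mul, CFC.sqrt_mul_sqrt_self x hx.1]
    have hz' : (z : A⁺¹) = q * m ^ 2 * q := hz
    refine ⟨Unitization.inr_nonneg_iff.1 ?_, ?_⟩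
    · rw [hz']
      simpa only [hqs] using star_left_conjugate_nonneg hm20 q
    · refine le_trans ?_ hx.2
      rw [hz', ← hqq]
      simpa only [hqs, mul_one] using star_left_conjugate_le_conjugate hm2 q
  | herm =>
    have hz' : (z : A⁺¹) = m * x * m := hz
    constructor
    · have h := star_left_conjugate_le_conjugate hx.1 m
      rw [hms, mul_neg, neg_mul, hconj, ← hz'] at h
      exact (neg_le_neg (hle E hE)).trans h
    · have h := star_left_conjugate_le_conjugate hx.2 m
      rw [hms, hconj, ← hz'] at h
      exact h.trans (hle F hF)
  | gen =>
    have hz' : (z : A⁺¹) = x * m ^ 2 := hz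
    have hn : ‖m‖ ≤ 1 := norm_le_one_of_nonneg_of_le_one h0 h1
    change ‖z‖ ≤ G
    rw [← Unitization.norm_inr (𝕜 := ℂ), hz', sq, ← mul_assoc]
    calc ‖(x : A⁺¹) * m * m‖ ≤ ‖(x : A⁺¹) * m‖ := (norm_mul_le _ _).trans
          (mul_le_of_le_one_right (norm_nonneg _) hn)
      _ ≤ ‖(x : A⁺¹)‖ := (norm_mul_le _ _).trans (mul_le_of_le_one_right (norm_nonneg _) hn)
      _ ≤ G := by rw [Unitization.norm_inr]; exact hx

lemma tendsto_adjust {α : Type*} {l : Filter α} {m' : α → A⁺¹} {m : A⁺¹}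
    (hm : Tendsto m' l (𝓝 m)) (x : A) (κ : VarKind) :
    Tendsto (fun u => κ.adjust (m' u) x) l (𝓝 (κ.adjust m x)) := by
  have hc : ∀ b : A⁺¹, Tendsto (fun _ : α => b) l (𝓝 b) := fun b => tendsto_const_nhds
  cases κ with
  | pos => exact ((hc _).mul (hm.pow 2)).mul (hc _)
  | herm => exact (hm.mul (hc _)).mul hm
  | gen => exact (hc _).mul (hm.pow 2)

/-- Each kind of adjustment is a word containing `m` exactly twice, whence `W u ^ 2`. In the
alphabet `Option A⁺¹`, `none` stands for `m` (degree 1) and `some b` for a fixed element (degree 0).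
-/
lemma tendsto_adjust_sub {α : Type*} {l : Filter α} {m' W : α → A⁺¹} {m : A⁺¹}
    (hW : ∀ᶠ u in l, ‖W u‖ ≤ 1)
    (hWc : ∀ b : A⁺¹, Tendsto (fun u => W u * b - b * W u) l (𝓝 0))
    (hm : Tendsto (fun u => m' u - m * W u) l (𝓝 0)) (x : A) (κ : VarKind) :
    Tendsto (fun u => κ.adjust (m' u) x - κ.adjust m x * W u ^ 2) l (𝓝 0) := by
  have h := tendsto_word_sub (L := Option A⁺¹) hW hWc (c := fun o => o.getD m)
    (c' := fun u o => o.getD (m' u)) (fun o => o.elim 1 fun _ => 0) (fun o => by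
      cases o with
      | none => simpa using hm
      | some b => simpa using tendsto_const_nhds)
  cases κ with
  | pos =>
    simpa [adjust, sq, mul_assoc] using
      h [some ((CFC.sqrt x : A) : A⁺¹), none, none, some ((CFC.sqrt x : A) : A⁺¹)]
  | herm => simpa [adjust, sq, mul_assoc] using h [none, some (x : A⁺¹), none]
  | gen => simpa [adjust, sq, mul_assoc] using h [some (x : A⁺¹), none, none]

end VarKind

end Adjust

/-! ### Iterated norm reduction and the limit multiplier. -/

section Lifting

/-- Right multiplication by powers of a contraction. -/
lemma norm_mul_pow_succ_le {B : Type u} [CStarAlgebra B] (a : B) {w : B} (hw : ‖w‖ ≤ 1) (n : ℕ) :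
    ‖a * w ^ (n + 1)‖ ≤ ‖a * w‖ := by
  induction n with
  | zero => simp
  | succ n ih =>
    rw [pow_succ, ← mul_assoc]
    exact ((norm_mul_le _ _).trans (mul_le_of_le_one_right (norm_nonneg _) hw)).trans ih

variable {r : ℕ} {A : Type u} [NonUnitalCStarAlgebra A]

lemma NCStarPoly.tendsto_eval {α : Type*} {l : Filter α} {z' : α → Fin r → A} {z : Fin r → A}
    {y : ℕ → A} (hz : ∀ k, Tendsto (fun u => (z' u k : A⁺¹)) l (𝓝 (z k)))
    (p : NCStarPoly (MixedVar r)) :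
    Tendsto (fun u => p.eval (Sum.elim (z' u) y)) l (𝓝 (p.eval (Sum.elim z y))) := by
  simp only [eval_eq_lift]
  refine tendsto_lift (fun x => ?_) p
  rcases x with (k | n) | (k | n)
  · exact hz k
  · exact tendsto_const_nhds
  · simpa only [letterValue, Sum.elim_inl, Unitization.inr_star] using (hz k).star
  · exact tendsto_const_nhds

lemma NCStarPoly.IsHomogeneousInX.tendsto_eval_sub {α : Type*} {l : Filter α} {W : α → A⁺¹}
    (hW : ∀ᶠ u in l, ‖W u‖ ≤ 1 ∧ IsSelfAdjoint (W u))
    (hWc : ∀ b : A⁺¹, Tendsto (fun u => W u * b - b * W u) l (𝓝 0))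
    {z' : α → Fin r → A} {z : Fin r → A} {y : ℕ → A}
    (hz : ∀ k, Tendsto (fun u => (z' u k : A⁺¹) - z k * W u) l (𝓝 0))
    {p : NCStarPoly (MixedVar r)} {d : ℕ} (hp : p.IsHomogeneousInX d) :
    Tendsto (fun u => p.eval (Sum.elim (z' u) y) - p.eval (Sum.elim z y) * W u ^ d) l (𝓝 0) := by
  simp only [eval_eq_lift]
  refine tendsto_lift_sub (hW.mono fun _ h => h.1) hWc xDegree (fun x => ?_) hp.mem_span
  rcases x with (k | n) | (k | n)
  · simpa [letterValue, xDegree] using hz k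
  · simpa [letterValue, xDegree] using tendsto_const_nhds
  · have h := (hz k).star.add (hWc (star (z k : A⁺¹)))
    rw [star_zero, add_zero] at h
    refine h.congr' ?_
    filter_upwards [hW] with u hu
    simp [letterValue, xDegree, hu.2.star_eq]
  · simpa [letterValue, xDegree] using tendsto_const_nhds

/-- The value of a homogeneous polynomial whose image in the quotient is small. -/
lemma exists_star_mul_self_eval_le {I : CStarIdeal A} {p : NCStarPoly (MixedVar r)} {d : ℕ}
    (hd : 1 ≤ d) (hp : p.IsHomogeneousInX d) {C : ℝ} (w : MixedVar r → A)
    (hw : ‖p.eval fun v => I.π (w v)‖ ≤ C) :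
    ∃ i ∈ I.unitizationIdeal, 0 ≤ i ∧
      star (p.eval w) * p.eval w ≤ algebraMap ℝ A⁺¹ (C ^ 2) + i ∧
      ∀ R, ‖p.eval w‖ ≤ R → C ≤ R → ‖i‖ ≤ R ^ 2 - C ^ 2 := by
  -- Positive degree excludes a constant term, so the value lies in `A` itself.
  obtain ⟨a, ha⟩ : ∃ a : A, p.eval w = (a : A⁺¹) :=
    ⟨(p.eval w).snd, by ext <;> simp [hp.fst_eval hd]⟩
  rw [NCStarPoly.eval_comp, ha] at hw
  have : Unitization.starMap I.π (a : A⁺¹) = ((I.π a : I.Quotient) : I.Quotient⁺¹) := by simp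
  rw [this, Unitization.norm_inr] at hw
  rw [ha, Unitization.norm_inr]
  exact I.exists_star_mul_self_le hw

variable [PartialOrder A] [StarOrderedRing A]

/-- The tuple of adjusted variables. -/
noncomputable def adjustedTuple (kind : Fin r → VarKind) (x : Fin r → A) (m : A⁺¹) (k : Fin r) : A :=
  ((kind k).adjust m (x k)).snd

lemma inr_adjustedTuple (kind : Fin r → VarKind) (x : Fin r → A) (m : A⁺¹) (k : Fin r) :
    ((adjustedTuple kind x m k : A) : A⁺¹) = (kind k).adjust m (x k) :=
  VarKind.inr_snd_adjust _ _ _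

lemma π_adjustedTuple {I : CStarIdeal A} {kind : Fin r → VarKind} {D E F G : Fin r → ℝ}
    {x : Fin r → A} (hx : ∀ k, (kind k).Restriction (D k) (E k) (F k) (G k) (x k)) {m : A⁺¹}
    (hm : m - 1 ∈ I.unitizationIdeal) (k : Fin r) :
    I.π (adjustedTuple kind x m k) = I.π (x k) := by
  rw [I.π_eq_π, inr_adjustedTuple]
  exact VarKind.adjust_sub_mem (hx k) hm

/-- One step of the norm reduction for finitely many polynomials. -/
lemma exists_norm_reduction {J : ℕ} {p : Fin J → NCStarPoly (MixedVar r)} {d : Fin J → ℕ}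
    (hd : ∀ j, 1 ≤ d j) (hp : ∀ j, (p j).IsHomogeneousInX (d j)) {C : Fin J → ℝ}
    (hC : ∀ j, 0 < C j) {kind : Fin r → VarKind} {D E F G : Fin r → ℝ}
    {I : CStarIdeal A} {x : Fin r → A} {y : ℕ → A}
    (hx : ∀ k, (kind k).Restriction (D k) (E k) (F k) (G k) (x k))
    (hpC : ∀ j, ‖(p j).eval (Sum.elim (fun k => I.π (x k)) (fun n => I.π (y n)))‖ ≤ C j)
    {m : A⁺¹} (hmI : m - 1 ∈ I.unitizationIdeal) (hm0 : 0 ≤ m) (hm1 : m ≤ 1) {δ ε η : ℝ}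
    (hδ0 : 0 ≤ δ) (hδ1 : δ ≤ 1) (hε : 0 ≤ ε) (hη : 0 < η)
    (hδε : ∀ j, (1 - δ) * (C j + ε) ≤ C j)
    (hm : ∀ j, ‖(p j).eval (Sum.elim (adjustedTuple kind x m) y)‖ ≤ C j + ε) :
    ∃ m' : A⁺¹, m' - 1 ∈ I.unitizationIdeal ∧ 0 ≤ m' ∧ m' ≤ 1 ∧ ‖m - m'‖ ≤ δ ∧
      ∀ j, ‖(p j).eval (Sum.elim (adjustedTuple kind x m') y)‖ ≤ C j + η := by
  obtain ⟨l, hl, hlI, hlc, hlu⟩ := exists_quasicentral_approx_unit I.unitizationIdeal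
  set s : A⁺¹ := CFC.sqrt m with hs
  have hss : s * s = m := CFC.sqrt_mul_sqrt_self m
  have hsa : star s = s := (CFC.sqrt_nonneg m).isSelfAdjoint.star_eq
  have hsn : ‖s‖ * ‖s‖ ≤ 1 := by
    rw [← CStarRing.norm_star_mul_self, hsa, hss]
    exact norm_le_one_of_nonneg_of_le_one hm0 hm1
  set w : A⁺¹ → A⁺¹ := fun u => 1 - δ • u with hw
  -- The symmetric form keeps `0 ≤ m' ≤ m`, and is asymptotically `m * w u`.
  set m' : A⁺¹ → A⁺¹ := fun u => s * w u * s with hm'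
  have hm'e : ∀ u, m - m' u = δ • (s * u * s) := fun u => by
    simp only [hm', hw, mul_sub, sub_mul, mul_one, hss, mul_smul_comm, smul_mul_assoc]
    abel
  have hw1 : ∀ᶠ u in l, 0 ≤ w u ∧ w u ≤ 1 := by
    filter_upwards [hlI] with u hu
    have h1 : δ • u ≤ 1 := calc
      δ • u ≤ δ • 1 := smul_le_smul_of_nonneg_left hu.2.2 hδ0
      _ ≤ (1 : ℝ) • 1 := smul_le_smul_of_nonneg_right hδ1 zero_le_one
      _ = 1 := one_smul _ _
    exact ⟨sub_nonneg.2 h1, sub_le_self _ (smul_nonneg hδ0 hu.2.1)⟩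
  have hwn : ∀ᶠ u in l, ‖w u‖ ≤ 1 :=
    hw1.mono fun u hu => norm_le_one_of_nonneg_of_le_one hu.1 hu.2
  have hwc : ∀ b : A⁺¹, Tendsto (fun u => w u * b - b * w u) l (𝓝 0) := fun b => by
    have h := (hlc b).const_smul (-δ)
    rw [smul_zero] at h
    refine h.congr fun u => ?_
    simp only [hw, mul_sub, sub_mul, mul_one, one_mul, mul_smul_comm, smul_mul_assoc]
    module
  have hmw : Tendsto (fun u => m' u - m * w u) l (𝓝 0) := by
    have h := (tendsto_const_nhds (x := s) (f := l)).mul (hwc s)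
    rw [mul_zero] at h
    refine h.congr fun u => ?_
    rw [← hss]
    simp only [hm']
    noncomm_ring
  have hW : ∀ᶠ u in l, ‖w u ^ 2‖ ≤ 1 ∧ IsSelfAdjoint (w u ^ 2) := by
    filter_upwards [hw1, hwn] with u hu hu2
    refine ⟨?_, hu.1.isSelfAdjoint.pow 2⟩
    rw [sq]
    exact (norm_mul_le _ _).trans (mul_le_one₀ hu2 (norm_nonneg _) hu2)
  have hWc : ∀ b : A⁺¹, Tendsto (fun u => w u ^ 2 * b - b * w u ^ 2) l (𝓝 0) := fun b => by
    have hwb : IsBoundedUnder (· ≤ ·) l (norm ∘ w) := ⟨1, eventually_map.2 hwn⟩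
    have h := (isBoundedUnder_le_mul_tendsto_zero hwb (hwc b)).add
      ((hwc b).zero_mul_isBoundedUnder_le hwb)
    rw [add_zero] at h
    refine h.congr fun u => ?_
    noncomm_ring
  have hev : ∀ j, ∀ᶠ u in l,
      ‖(p j).eval (Sum.elim (adjustedTuple kind x (m' u)) y)‖ ≤ C j + η := fun j => by
    have hzc : (fun v => I.π (Sum.elim (adjustedTuple kind x m) y v)) =
        Sum.elim (fun k => I.π (x k)) (fun n => I.π (y n)) := by
      funext v
      rcases v with k | n
      · exact π_adjustedTuple hx hmI k
      · rfl
    obtain ⟨i, hiI, hi0, hi1, hiR⟩ := exists_star_mul_self_eval_le (I := I) (C := C j) (hd j) (hp j)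
      (Sum.elim (adjustedTuple kind x m) y) (by rw [hzc]; exact hpC j)
    have h1 := eventually_norm_mul_le hlI hlu hiI hi0 hi1 (hiR _ (hm j) (by linarith)) (hC j).le
      (add_nonneg (hC j).le hε) hδ0 hδ1 (hδε j) (half_pos hη)
    have h2 := (hp j).tendsto_eval_sub (y := y) hW hWc
      (z' := fun u => adjustedTuple kind x (m' u)) (z := adjustedTuple kind x m) fun k => by
        simp only [inr_adjustedTuple]
        exact VarKind.tendsto_adjust_sub hwn hwc hmw (x k) (kind k)
    have h3 : ∀ᶠ u in l, ‖(p j).eval (Sum.elim (adjustedTuple kind x (m' u)) y) -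
        (p j).eval (Sum.elim (adjustedTuple kind x m) y) * (w u ^ 2) ^ d j‖ < η / 2 :=
      (by simpa using h2.norm : Tendsto _ l (𝓝 (0 : ℝ))).eventually_lt_const (half_pos hη)
    filter_upwards [h1, h3, hwn] with u hu1 hu3 hu4
    -- As `2 * d j ≥ 1`, all but one of the contractions `w u` can be dropped.
    obtain ⟨n, hn⟩ : ∃ n, 2 * d j = n + 1 := ⟨2 * d j - 1, by have := hd j; omega⟩
    have h4 := norm_mul_pow_succ_le ((p j).eval (Sum.elim (adjustedTuple kind x m) y)) hu4 n
    rw [← hn, pow_mul] at h4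
    have h5 := norm_le_norm_sub_add ((p j).eval (Sum.elim (adjustedTuple kind x (m' u)) y))
      ((p j).eval (Sum.elim (adjustedTuple kind x m) y) * (w u ^ 2) ^ d j)
    linarith
  obtain ⟨u, hu, huw, huI, hu0, hu1⟩ := ((eventually_all.2 hev).and (hw1.and hlI)).exists
  have hsu : 0 ≤ s * u * s := by simpa only [hsa] using star_left_conjugate_nonneg hu0 s
  refine ⟨m' u, ?_, ?_, ?_, ?_, hu⟩
  · have e : m' u - 1 = (m - 1) - δ • (s * u * s) := by rw [← hm'e]; abel
    rw [e, ← one_mul (s * u * s), ← smul_mul_assoc]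
    exact sub_mem hmI (Ideal.mul_mem_left _ _ (Ideal.mul_mem_right _ _ (Ideal.mul_mem_left _ _ huI)))
  · simpa only [hsa] using star_left_conjugate_nonneg huw.1 s
  · refine le_trans (sub_nonneg.1 ?_) hm1
    rw [hm'e]
    exact smul_nonneg hδ0 hsu
  · rw [hm'e, norm_smul, Real.norm_of_nonneg hδ0]
    refine mul_le_of_le_one_right hδ0 ?_
    have hun := norm_le_one_of_nonneg_of_le_one hu0 hu1
    calc ‖s * u * s‖ ≤ ‖s‖ * ‖u‖ * ‖s‖ := norm_mul₃_le
      _ ≤ ‖s‖ * 1 * ‖s‖ := by gcongr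
      _ ≤ 1 := by rwa [mul_one]

/-- The multiplier obtained as a limit of norm reductions. -/
lemma exists_multiplier {J : ℕ} {p : Fin J → NCStarPoly (MixedVar r)} {d : Fin J → ℕ}
    (hd : ∀ j, 1 ≤ d j) (hp : ∀ j, (p j).IsHomogeneousInX (d j)) {C : Fin J → ℝ}
    (hC : ∀ j, 0 < C j) {kind : Fin r → VarKind} {D E F G : Fin r → ℝ}
    {I : CStarIdeal A} {x : Fin r → A} {y : ℕ → A}
    (hx : ∀ k, (kind k).Restriction (D k) (E k) (F k) (G k) (x k))
    (hpC : ∀ j, ‖(p j).eval (Sum.elim (fun k => I.π (x k)) (fun n => I.π (y n)))‖ ≤ C j) :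
    ∃ m : A⁺¹, m - 1 ∈ I.unitizationIdeal ∧ 0 ≤ m ∧ m ≤ 1 ∧
      ∀ j, ‖(p j).eval (Sum.elim (adjustedTuple kind x m) y)‖ ≤ C j := by
  obtain ⟨c, hc0, hcC⟩ : ∃ c : ℝ, 0 < c ∧ ∀ j, c ≤ C j := by
    rcases isEmpty_or_nonempty (Fin J) with h | h
    · exact ⟨1, one_pos, fun j => h.elim j⟩
    · obtain ⟨j, hj⟩ := Finite.exists_min C
      exact ⟨C j, hC j, hj⟩
  obtain ⟨K, hK0, hK⟩ : ∃ K : ℝ, 0 < K ∧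
      ∀ j, ‖(p j).eval (Sum.elim (adjustedTuple kind x 1) y)‖ ≤ K :=
    ⟨1 + ∑ j, ‖(p j).eval (Sum.elim (adjustedTuple kind x 1) y)‖,
      by positivity, fun j => (Finset.single_le_sum
        (f := fun j => ‖(p j).eval (Sum.elim (adjustedTuple kind x 1) y)‖)
        (fun j _ => norm_nonneg _) (Finset.mem_univ j)).trans (by linarith)⟩
  let Good : ℕ → A⁺¹ → Prop := fun n m => m - 1 ∈ I.unitizationIdeal ∧ 0 ≤ m ∧ m ≤ 1 ∧
    ∀ j, ‖(p j).eval (Sum.elim (adjustedTuple kind x m) y)‖ ≤ C j + K / 2 ^ n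
  have hstep : ∀ n m, Good n m → ∃ m', Good (n + 1) m' ∧ ‖m - m'‖ ≤ (2 * (K / c)) / 2 / 2 ^ n := by
    rintro n m ⟨h1, h2, h3, h4⟩
    have hε : 0 < K / 2 ^ n := by positivity
    set ε := K / 2 ^ n with hεdef
    -- Here `1 - δ = c / (c + ε)`, and `c (C j + ε) ≤ C j (c + ε)` amounts to `c ≤ C j`.
    have hδε : ∀ j, (1 - ε / (c + ε)) * (C j + ε) ≤ C j := fun j => by
      rw [one_sub_div (by positivity), add_sub_cancel_right, div_mul_eq_mul_div,
        div_le_iff₀ (by positivity)]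
      nlinarith [hcC j]
    obtain ⟨m', g1, g2, g3, g4, g5⟩ := exists_norm_reduction hd hp hC hx hpC h1 h2 h3
      (δ := ε / (c + ε)) (ε := ε) (η := K / 2 ^ (n + 1)) (by positivity)
      ((div_le_one (by positivity)).2 (by linarith)) hε.le (by positivity) hδε h4
    refine ⟨m', ⟨g1, g2, g3, g5⟩, g4.trans ?_⟩
    calc ε / (c + ε) ≤ ε / c := by gcongr; linarith
      _ = 2 * (K / c) / 2 / 2 ^ n := by rw [hεdef]; field_simp
  choose! next hnext hdist using hstep
  let m : ℕ → A⁺¹ := fun n => Nat.rec 1 (fun n b => next n b) n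
  have hgood : ∀ n, Good n (m n) := fun n => by
    induction n with
    | zero =>
      refine ⟨by simp [m], zero_le_one, le_rfl, fun j => ?_⟩
      rw [pow_zero, div_one]
      exact (hK j).trans (by linarith [hC j])
    | succ n ih => exact hnext n _ ih
  have hcauchy : CauchySeq m := cauchySeq_of_le_geometric_two (C := 2 * (K / c)) fun n => by
    rw [dist_eq_norm]
    exact hdist n _ (hgood n)
  obtain ⟨b, hb⟩ := cauchySeq_tendsto_of_complete hcauchy
  refine ⟨b, ?_, ?_, ?_, fun j => ?_⟩
  · exact I.isClosed_unitizationIdeal.mem_of_tendsto (hb.sub_const 1)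
      (.of_forall fun n => (hgood n).1)
  · exact ge_of_tendsto hb (.of_forall fun n => (hgood n).2.1)
  · exact le_of_tendsto hb (.of_forall fun n => (hgood n).2.2.1)
  · have h1 : Tendsto (fun n : ℕ => C j + K / 2 ^ n) atTop (𝓝 (C j)) := by
      have : Tendsto (fun n : ℕ => K * (1 / 2) ^ n) atTop (𝓝 (K * 0)) :=
        (tendsto_pow_atTop_nhds_zero_of_lt_one (by norm_num) (by norm_num)).const_mul K
      simpa [div_eq_mul_inv] using this.const_add (C j)
    refine le_of_tendsto_of_tendsto' (NCStarPoly.tendsto_eval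
      (z' := fun n => adjustedTuple kind x (m n)) (fun k => ?_) (p j)).norm h1
      fun n => (hgood n).2.2.2 j
    simp only [inr_adjustedTuple]
    exact VarKind.tendsto_adjust hb (x k) (kind k)

end Lifting

theorem theorem3p2 {r J : ℕ} (p : Fin J → NCStarPoly (MixedVar r)) (d : Fin J → ℕ)
    (hd : ∀ j, 1 ≤ d j) (hp : ∀ j, (p j).IsHomogeneousInX (d j))
    (C : Fin J → ℝ) (hC : ∀ j, 0 < C j)
    (kind : Fin r → VarKind) (D E F G : Fin r → ℝ)
    (hD : ∀ k, 0 ≤ D k) (hE : ∀ k, 0 ≤ E k) (hF : ∀ k, 0 ≤ F k) (hG : ∀ k, 0 ≤ G k)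
    {A : Type u} [NonUnitalCStarAlgebra A] [PartialOrder A] [StarOrderedRing A]
    (I : CStarIdeal A) (x : Fin r → A) (y : ℕ → A)
    (hx : ∀ k, (kind k).Restriction (D k) (E k) (F k) (G k) (x k))
    (hpC : ∀ j, ‖(p j).eval (Sum.elim (fun k => I.π (x k)) (fun n => I.π (y n)))‖ ≤ C j) :
    ∃ z : Fin r → A,
      (∀ k, (kind k).Restriction (D k) (E k) (F k) (G k) (z k)) ∧
      (∀ j, ‖(p j).eval (Sum.elim z y)‖ ≤ C j) ∧
      (∀ k, I.π (z k) = I.π (x k)) ∧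
      ∃ m : A⁺¹, (∃ i ∈ I.toSubmodule, m = 1 + (i : A⁺¹)) ∧ 0 ≤ m ∧ m ≤ 1 ∧
        ∀ k, ((z k : A) : A⁺¹) = (kind k).adjust m (x k) := by
  obtain ⟨m, hmI, hm0, hm1, hm⟩ := exists_multiplier hd hp hC hx hpC
  refine ⟨adjustedTuple kind x m, fun k => (hx k).of_eq_adjust (hE k) (hF k) hm0 hm1
    (inr_adjustedTuple kind x m k), hm, π_adjustedTuple hx hmI, m, ?_, hm0, hm1,
    inr_adjustedTuple kind x m⟩
  obtain ⟨i, hi, h⟩ := hmI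
  exact ⟨i, hi, by rw [← h]; abel⟩
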